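/- All hypergraphs are finite and have no repeated edges. For a hypergraph $\mathcal H$, its Zagreb index is $M(\mathcal H)=\sum_{u\in V(\mathcal H)} d_{\mathcal H}(u)^2$, where $d_{\mathcal H}(u)$ is the number of edges containing $u$; its girth is the minimum length of its hypercycles. A connected $k$-uniform hypergraph with $n$ vertices and $m$ edges is called bicyclic if $n=m(k-1)-1$. Let $k\ge 3$, and let $P_p=(u_1,e_1,u_2,\dots,e_p,u_{p+1})$, $P_q=(v_1,f_1,v_2,\dots,f_q,v_{q+1})$ and $P_l=(w_1,g_1,w_2,\dots,g_l,w_{l+1})$ be three disjoint $k$-uniform hyperpaths of lengths $p,q,l\ge 1$ (consecutive edges share exactly the indicated vertex, non-consecutive edges are disjoint, and the end vertices $u_1,u_{p+1},v_1,v_{q+1},w_1,w_{l+1}$ have degree one in their paths). * For $p=1<q\le l$ or $1<p\le q\le l$, let $C^k_{1,p,q,l}$ be obtained by identifying $u_1,v_1,w_1$, and identifying $u_{p+1},v_{q+1},w_{l+1}$. * For $q=1<p\le l$, or $q>1$ and $1\le p\le q-1\le l$, let $C^k_{2,p,q,l}$ be obtained by identifying $u_1,v_1,w_1$, identifying $u_{p+1}$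 with $v_{q+1}$, and identifying $w_{l+1}$ with a vertex of $f_q\setminus\{v_q,v_{q+1}\}$. * For $q>2$ and $1\le p\le q-2\le l$, or $q=2$ and $1\le p\le l$, or $q=1$, $k>3$ and $1<p\le l$, let $C^k_{3,p,q,l}$ be obtained by identifying $u_1$ with $v_1$, identifying $u_{p+1}$ with $v_{q+1}$, identifying $w_1$ with a vertex $v'\in f_1\setminus\{v_1,v_2\}$, and identifying $w_{l+1}$ with a vertex $v''\in f_q\setminus\{v_q,v_{q+1}\}$, where $v'\ne v''$. Each of these is determined up to isomorphism by $k,p,q,l$. For $n=m(k-1)-1$, let $\mathcal C^k_n$ be the class of all $k$-uniform bicyclic hypergraphs with $n$ vertices and $m$ edges that contain some $C^k_{i,p,q,l}$, with $i\in\{1,2,3\}$ and $p,q,l$ as above, as a sub-hypergraph. For $i\in\{1,2\}$ and $m\ge p+q+l$, let $C^k_{i,n,p,q,l}(m-p-q-l)$ be obtained from $C^k_{i,p,q,l}$ by attaching $m-p-q-l$ pendant edges (each consisting of the vertex of attachment and $k-1$ new vertices) at a vertex of degree $3$; for $i=1$ there are two such vertices, and both choices give isomorphic results. **Theorem.** Let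 $k\ge 3$ and $n=m(k-1)-1$. 1. Let $g\ge 3$ and $m\ge \frac{3g}{2}$. If $g$ is even, then $C^k_{1,n,\frac g2,\frac g2,\frac g2}\left(m-\frac{3g}{2}\right)$ lies in $\mathcal C^k_n$, has girth $g$, and is, up to isomorphism, the unique hypergraph with maximum Zagreb index among all hypergraphs of girth $g$ in $\mathcal C^k_n$. 2. Let $g\ge 3$ and $m\ge \frac{3g}{2}$. If $g$ is odd, then $C^k_{2,n,\lfloor\frac g2\rfloor,\lceil\frac g2\rceil,\lfloor\frac g2\rfloor}\left(m-g-\lfloor\frac g2\rfloor\right)$ lies in $\mathcal C^k_n$, has girth $g$, and is, up to isomorphism, the unique hypergraph with maximum Zagreb index among all hypergraphs of girth $g$ in $\mathcal C^k_n$. 3. If $m\ge 6$, then $C^k_{2,n,1,2,1}(m-4)$ lies in $\mathcal C^k_n$ and is, up to isomorphism, the unique hypergraph with maximum Zagreb index among all hypergraphs in $\mathcal C^k_n$. -/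

import Mathlib

namespace Hypergraph

/-- The degree of `v`: the number of edges containing `v`. -/
noncomputable def degree {α : Type*} (H : Hypergraph α) (v : α) : ℕ :=
  {e | e ∈ H.edgeSet ∧ v ∈ e}.ncard

/-- The Zagreb index: the sum of the squares of the vertex degrees (used for finite `H`). -/
noncomputable def zagreb {α : Type*} (H : Hypergraph α) : ℕ :=
  ∑ᶠ v ∈ H.vertexSet, H.degree v ^ 2

/-- Every edge has exactly `k` vertices. -/
def IsUniform {α : Type*} (H : Hypergraph α) (k : ℕ) : Prop :=
  ∀ e ∈ H.edgeSet, e.encard = k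

/-- Any two vertices are joined by a walk (and there is a vertex). -/
def IsConnected {α : Type*} (H : Hypergraph α) : Prop :=
  H.vertexSet.Nonempty ∧
    ∀ x ∈ H.vertexSet, ∀ y ∈ H.vertexSet, Relation.ReflTransGen H.Adj x y

/-- A `k`-uniform bicyclic hypergraph with `n` vertices and `m` edges: connected, `k`-uniform,
and `n = m (k - 1) - 1`. (`encard` makes the vertex set and the edge set finite.) -/
structure IsBicyclic {α : Type*} (H : Hypergraph α) (k n m : ℕ) : Prop where
  uniform : H.IsUniform k
  connected : H.IsConnected
  card_vertexSet : H.vertexSet.encard = n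
  card_edgeSet : H.edgeSet.encard = m
  bicyclic : (n : ℤ) = m * ((k : ℤ) - 1) - 1

/-- `H` has a hypercycle of length `L ≥ 2`: distinct vertices `x 0, …, x (L - 1)` and distinct
edges `e 0, …, e (L - 1)` such that `e i` contains `x i` and its cyclic successor. -/
def HasHypercycle {α : Type*} (H : Hypergraph α) (L : ℕ) : Prop :=
  2 ≤ L ∧ ∃ (x : ℕ → α) (e : ℕ → Set α),
    Set.InjOn x (Set.Iio L) ∧ Set.InjOn e (Set.Iio L) ∧
    ∀ i < L, e i ∈ H.edgeSet ∧ x i ∈ e i ∧ x ((i + 1) % L) ∈ e i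

/-- The girth of `H` is `g`: the minimum length of a hypercycle of `H` exists and equals `g`. -/
def HasGirth {α : Type*} (H : Hypergraph α) (g : ℕ) : Prop :=
  IsLeast {L | H.HasHypercycle L} g

/-- `H'` is isomorphic to `H`: it is the image of `H` under a map injective on the vertices. -/
def IsIso {α β : Type*} (H : Hypergraph α) (H' : Hypergraph β) : Prop :=
  ∃ f : α → β, Set.InjOn f H.vertexSet ∧ H.image f = H'

/-- `H` contains (an isomorphic copy of) `C` as a sub-hypergraph. -/
def ContainsCopy {α β : Type*} (H : Hypergraph α) (C : Hypergraph β) : Prop :=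
  ∃ f : β → α, Set.InjOn f C.vertexSet ∧
    (C.image f).vertexSet ⊆ H.vertexSet ∧ (C.image f).edgeSet ⊆ H.edgeSet

/-- The `k`-uniform hyperpath of length `p`, on the vertices `0, 1, …, p (k - 1)`. Its `i`-th edge
(`i < p`, counted from `0`) is the block `{i (k - 1), …, (i + 1) (k - 1)}`, so consecutive edges
share exactly one vertex. Its two end vertices are `0` and `p (k - 1)`. -/
def hyperpath (k p : ℕ) : Hypergraph ℕ where
  vertexSet := Set.Iic (p * (k - 1))
  edgeSet := {e | ∃ i < p, e = Set.Icc (i * (k - 1)) ((i + 1) * (k - 1))}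
  subset_vertexSet_of_mem_edgeSet' := by
    rintro e ⟨i, hi, rfl⟩ x hx
    exact hx.2.trans (Nat.mul_le_mul_right _ hi)

/-- The disjoint union of three `k`-uniform hyperpaths `P_p`, `P_q`, `P_l` of lengths `p`, `q`, `l`.
The pair `(0, i)`, `(1, i)`, `(2, i)` is the vertex `i` of `P_p`, `P_q`, `P_l`, respectively. -/
def threePaths (k p q l : ℕ) : Hypergraph (Fin 3 × ℕ) where
  vertexSet := ⋃ j : Fin 3, Prod.mk j '' (hyperpath k (![p, q, l] j)).vertexSet
  edgeSet := ⋃ j : Fin 3, Set.image (Prod.mk j) '' (hyperpath k (![p, q, l] j)).edgeSet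
  subset_vertexSet_of_mem_edgeSet' := by
    intro e he
    obtain ⟨j, e', he', rfl⟩ := Set.mem_iUnion.1 he
    exact (Set.image_mono
      ((hyperpath k (![p, q, l] j)).subset_vertexSet_of_mem_edgeSet' he')).trans
      (Set.subset_iUnion (fun j : Fin 3 =>
        Prod.mk j '' (hyperpath k (![p, q, l] j)).vertexSet) j)

/-- The three initial vertices of the paths are identified, and so are the three final vertices. -/
def thetaOne (k p q l : ℕ) : Hypergraph (Fin 3 × ℕ) :=
  (threePaths k p q l).image fun x =>
    if x = (1, 0) ∨ x = (2, 0) then (0, 0)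
    else if x = (1, q * (k - 1)) ∨ x = (2, l * (k - 1)) then (0, p * (k - 1))
    else x

/-- The three initial vertices are identified, the final vertices of `P_p` and `P_q` are identified,
and the final vertex of `P_l` is identified with a vertex of the last edge of `P_q` that is not one
of the two path vertices of that edge (namely its last vertex but one). -/
def thetaTwo (k p q l : ℕ) : Hypergraph (Fin 3 × ℕ) :=
  (threePaths k p q l).image fun x =>
    if x = (1, 0) ∨ x = (2, 0) then (0, 0)
    else if x = (1, q * (k - 1)) then (0, p * (k - 1))
    else if x = (2, l * (k - 1)) then (1, q * (k - 1) - 1)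
    else x

/-- The initial vertices of `P_p` and `P_q` are identified, and so are their final vertices. The
initial (final) vertex of `P_l` is identified with a vertex of the first (last) edge of `P_q` that
is not one of the two path vertices of that edge; the two chosen vertices are distinct. -/
def thetaThree (k p q l : ℕ) : Hypergraph (Fin 3 × ℕ) :=
  (threePaths k p q l).image fun x =>
    if x = (1, 0) then (0, 0)
    else if x = (1, q * (k - 1)) then (0, p * (k - 1))
    else if x = (2, 0) then (1, 1)
    else if x = (2, l * (k - 1)) then (1, q * (k - 1) - 1)
    else x

/-- The lengths allowed for `thetaOne`. -/
def ThetaOneLengths (p q l : ℕ) : Prop :=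
  (p = 1 ∧ 1 < q ∧ q ≤ l) ∨ (1 < p ∧ p ≤ q ∧ q ≤ l)

/-- The lengths allowed for `thetaTwo`. -/
def ThetaTwoLengths (p q l : ℕ) : Prop :=
  (q = 1 ∧ 1 < p ∧ p ≤ l) ∨ (1 < q ∧ 1 ≤ p ∧ p ≤ q - 1 ∧ q - 1 ≤ l)

/-- The lengths allowed for `thetaThree`. -/
def ThetaThreeLengths (k p q l : ℕ) : Prop :=
  (2 < q ∧ 1 ≤ p ∧ p ≤ q - 2 ∧ q - 2 ≤ l) ∨ (q = 2 ∧ 1 ≤ p ∧ p ≤ l) ∨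
    (q = 1 ∧ 3 < k ∧ 1 < p ∧ p ≤ l)

/-- The class of theta-type bicyclic hypergraphs: `k`-uniform bicyclic hypergraphs with `n` vertices
and `m` edges that contain one of the three kinds of theta hypergraphs as a sub-hypergraph. -/
def IsThetaBicyclic {α : Type*} (H : Hypergraph α) (k n m : ℕ) : Prop :=
  H.IsBicyclic k n m ∧ ∃ p q l : ℕ,
    (ThetaOneLengths p q l ∧ H.ContainsCopy (thetaOne k p q l)) ∨
    (ThetaTwoLengths p q l ∧ H.ContainsCopy (thetaTwo k p q l)) ∨
    (ThetaThreeLengths k p q l ∧ H.ContainsCopy (thetaThree k p q l))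

/-- Attach `t` pendant edges, each with `k` vertices, to `H` at its vertex `x`: the `s`-th new edge
(`s < t`) consists of `x` and the `k - 1` new vertices `(s, 0), …, (s, k - 2)`. -/
def attachPendant {α : Type*} (H : Hypergraph α) (x : α) (k t : ℕ) : Hypergraph (α ⊕ ℕ × ℕ) where
  vertexSet := Sum.inl '' insert x H.vertexSet ∪ Sum.inr '' (Set.Iio t ×ˢ Set.Iio (k - 1))
  edgeSet := Set.image Sum.inl '' H.edgeSet ∪
    {e | ∃ s < t, e = insert (Sum.inl x) (Sum.inr '' ({s} ×ˢ Set.Iio (k - 1)))}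
  subset_vertexSet_of_mem_edgeSet' := by
    rintro e (⟨e', he', rfl⟩ | ⟨s, hs, rfl⟩)
    · exact (Set.image_mono ((H.subset_vertexSet_of_mem_edgeSet' he').trans
        (Set.subset_insert _ _))).trans Set.subset_union_left
    · refine Set.insert_subset (Or.inl ⟨x, Set.mem_insert _ _, rfl⟩) ?_
      refine (Set.image_mono ?_).trans Set.subset_union_right
      exact Set.prod_mono (Set.singleton_subset_iff.2 hs) subset_rfl

/-- `thetaOne k p q l` with `t` pendant edges attached at a vertex of degree `3`: the common initial
vertex of the three paths. (The only other vertex of degree `3` is the common final vertex, and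
reversing the three paths exchanges the two.) -/
def thetaOneAttach (k p q l t : ℕ) : Hypergraph ((Fin 3 × ℕ) ⊕ ℕ × ℕ) :=
  (thetaOne k p q l).attachPendant (0, 0) k t

/-- `thetaTwo k p q l` with `t` pendant edges attached at its vertex of degree `3`: the common
initial vertex of the three paths. -/
def thetaTwoAttach (k p q l t : ℕ) : Hypergraph ((Fin 3 × ℕ) ⊕ ℕ × ℕ) :=
  (thetaTwo k p q l).attachPendant (0, 0) k t

end Hypergraph

/-! Let `H` contain a copy `D` of a theta hypergraph with `c = p + q + l` edges, and put `s = m -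
c`. The core `D` satisfies the same relation between vertices and edges as `H`, so exactly `s * (k -
1)` vertices of `H` lie outside `D`, each of degree at least one by connectedness. Let `δ` be the
degree in `D` on the core and `1` elsewhere. Comparing degree sums, the excess `y = deg - δ ≥ 0` has
total `s`. If `δ ≤ B`, expanding `∑ (δ + y) ^ 2` gives `H.zagreb ≤ D.zagreb + s * (k - 1) + 2 * B *
s + s ^ 2` (`IsCore.zagreb_le`). For `B ≥ 2` attained in `D`, equality forces all the excess onto
one core vertex of degree `B`; then every further edge is a pendant edge at that vertex
(`IsCore.degree_of_zagreb_eq`, `isIso_attachPendant_of_degree`).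

Theta degrees are at most `3`, and `D.zagreb = c * (k + 2) + 2 + 2 * t`, where `t` counts the
vertices of degree `3`: two, one and none in the three families. The upper bounds are therefore `m *
(k + 2)` plus `6 + 3 * s + s ^ 2`, `4 + 3 * s + s ^ 2` or `2 + s + s ^ 2`. Maximising means choosing
`c` small. The first two paths form a hypercycle of length `p + q`, so girth `g` gives `g ≤ p + q`,
and the length conditions then bound `c` from below; comparing the three bounds leaves one extremal
choice.

The candidate has the right girth because the edges of a hypercycle form a linked set, each edge
meeting the others in two distinct vertices. Such a set avoids pendant edges, and once it contains
an edge of a theta arm it contains the whole arm and a second one. -/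

namespace Hypergraph

/-! ### An inequality for sums of squares -/

theorem sum_sq_add_le {ι : Type*} (s : Finset ι) (δ y : ι → ℕ) (B : ℕ)
    (h : ∀ i ∈ s, δ i ≤ B) :
    ∑ i ∈ s, (δ i + y i) ^ 2 ≤
      ∑ i ∈ s, δ i ^ 2 + 2 * B * ∑ i ∈ s, y i + (∑ i ∈ s, y i) ^ 2 := by
  rw [sq (∑ i ∈ s, y i), Finset.mul_sum, Finset.sum_mul, ← Finset.sum_add_distrib,
    ← Finset.sum_add_distrib]
  refine Finset.sum_le_sum fun i hi => ?_
  have h1 := h i hi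
  have h2 : y i ≤ ∑ i ∈ s, y i := Finset.single_le_sum (fun _ _ => Nat.zero_le _) hi
  nlinarith [Nat.mul_le_mul_right (y i) h1, Nat.mul_le_mul_left (y i) h2]

/-- The inequality holds term by term, from `δ i ≤ B` and `y i ≤ ∑ y`; hence equality of the sums is
equality of all terms, and a nonzero `y i` makes both estimates sharp. -/
theorem eq_of_sum_sq_add_eq {ι : Type*} (s : Finset ι) (δ y : ι → ℕ) (B : ℕ)
    (h : ∀ i ∈ s, δ i ≤ B)
    (heq : ∑ i ∈ s, (δ i + y i) ^ 2 =
      ∑ i ∈ s, δ i ^ 2 + 2 * B * ∑ i ∈ s, y i + (∑ i ∈ s, y i) ^ 2) :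
    ∀ i ∈ s, y i ≠ 0 → δ i = B ∧ y i = ∑ i ∈ s, y i := by
  rw [sq (∑ i ∈ s, y i), Finset.mul_sum, Finset.sum_mul, ← Finset.sum_add_distrib,
    ← Finset.sum_add_distrib, Finset.sum_eq_sum_iff_of_le] at heq
  · intro i hi h0
    have h1 := h i hi
    have h2 : y i ≤ ∑ i ∈ s, y i := Finset.single_le_sum (fun _ _ => Nat.zero_le _) hi
    have h3 := heq i hi
    -- The added summand is exactly the gap between the two sides of the termwise inequality.
    have h4 : (δ i + y i) ^ 2 + y i * (2 * (B - δ i) + (∑ i ∈ s, y i - y i)) =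
        (δ i + y i) ^ 2 := by
      conv_rhs => rw [h3]
      obtain ⟨u, hu⟩ := Nat.exists_eq_add_of_le h1
      obtain ⟨w, hw⟩ := Nat.exists_eq_add_of_le h2
      rw [hu, hw, Nat.add_sub_cancel_left, Nat.add_sub_cancel_left]
      ring
    have h5 : y i * (2 * (B - δ i) + (∑ i ∈ s, y i - y i)) = 0 := by omega
    rcases Nat.mul_eq_zero.1 h5 with h6 | h6
    · exact absurd h6 h0
    · omega
  · intro i hi
    have h1 := h i hi
    have h2 : y i ≤ ∑ i ∈ s, y i := Finset.single_le_sum (fun _ _ => Nat.zero_le _) hi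
    nlinarith [Nat.mul_le_mul_right (y i) h1, Nat.mul_le_mul_left (y i) h2]

/-! ### Degree sums and the Zagreb index -/

open Classical in
theorem degree_eq_card_filter {α : Type*} (H : Hypergraph α) (hE : H.edgeSet.Finite) (v : α) :
    H.degree v = (hE.toFinset.filter (v ∈ ·)).card := by
  rw [degree, ← Set.ncard_coe_finset]
  congr 1
  ext e
  simp

theorem zagreb_eq_sum {α : Type*} (H : Hypergraph α) (hV : H.vertexSet.Finite) :
    H.zagreb = ∑ v ∈ hV.toFinset, H.degree v ^ 2 := by
  rw [zagreb, finsum_mem_eq_finite_toFinset_sum _ hV]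

theorem sum_degree {α : Type*} (H : Hypergraph α) (hV : H.vertexSet.Finite)
    (hE : H.edgeSet.Finite) {k : ℕ} (hk : H.IsUniform k) :
    ∑ v ∈ hV.toFinset, H.degree v = H.edgeSet.ncard * k := by
  classical
  simp_rw [H.degree_eq_card_filter hE]
  have := Finset.sum_card_bipartiteAbove_eq_sum_card_bipartiteBelow
    (s := hV.toFinset) (t := hE.toFinset) (fun v e => v ∈ e)
  simp only [Finset.bipartiteAbove, Finset.bipartiteBelow] at this
  rw [this, Set.ncard_eq_toFinset_card _ hE, ← smul_eq_mul]
  refine Finset.sum_const_nat fun e he => ?_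
  have he' : e ∈ H.edgeSet := by simpa using he
  have h1 : ((hV.toFinset.filter (· ∈ e) : Finset α) : Set α) = e := by
    ext x
    simpa using fun hx => H.mem_vertexSet_of_mem_edgeSet he' hx
  have h2 := hk e he'
  rw [← h1, Set.encard_coe_eq_coe_finsetCard] at h2
  exact_mod_cast h2

theorem degree_le_degree {α : Type*} {D H : Hypergraph α} (hE : H.edgeSet.Finite)
    (hDE : D.edgeSet ⊆ H.edgeSet) (v : α) : D.degree v ≤ H.degree v :=
  Set.ncard_le_ncard (fun _ he => ⟨hDE he.1, he.2⟩) (hE.subset fun _ he => he.1)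

theorem one_le_degree_iff {α : Type*} {H : Hypergraph α} (hE : H.edgeSet.Finite) (v : α) :
    1 ≤ H.degree v ↔ ∃ e ∈ H.edgeSet, v ∈ e := by
  have hfin : {e | e ∈ H.edgeSet ∧ v ∈ e}.Finite := hE.subset fun _ he => he.1
  rw [degree, Nat.one_le_iff_ne_zero, Ne, Set.ncard_eq_zero hfin, ← Ne,
    ← Set.nonempty_iff_ne_empty]
  rfl

theorem IsConnected.exists_edge {α : Type*} {H : Hypergraph α} (h : H.IsConnected)
    (hV : H.vertexSet.Nontrivial) {v : α} (hv : v ∈ H.vertexSet) : ∃ e ∈ H.edgeSet, v ∈ e := by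
  obtain ⟨w, hw, hne⟩ := hV.exists_ne v
  rcases Relation.ReflTransGen.cases_head (h.2 v hv w hw) with rfl | ⟨z, ⟨e, he, hve, -⟩, -⟩
  · exact absurd rfl hne
  · exact ⟨e, he, hve⟩

namespace IsBicyclic

variable {α : Type*} {H : Hypergraph α} {k n m : ℕ}

theorem finite_vertexSet (h : H.IsBicyclic k n m) : H.vertexSet.Finite :=
  Set.finite_of_encard_eq_coe h.card_vertexSet

theorem finite_edgeSet (h : H.IsBicyclic k n m) : H.edgeSet.Finite :=
  Set.finite_of_encard_eq_coe h.card_edgeSet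

theorem ncard_vertexSet (h : H.IsBicyclic k n m) : H.vertexSet.ncard = n := by
  rw [Set.ncard, h.card_vertexSet]; rfl

theorem ncard_edgeSet (h : H.IsBicyclic k n m) : H.edgeSet.ncard = m := by
  rw [Set.ncard, h.card_edgeSet]; rfl

theorem one_le_degree (h : H.IsBicyclic k n m) (hn : 2 ≤ n) {v : α} (hv : v ∈ H.vertexSet) :
    1 ≤ H.degree v := by
  rw [one_le_degree_iff h.finite_edgeSet]
  refine h.connected.exists_edge ?_ hv
  rw [← Set.one_lt_encard_iff_nontrivial, h.card_vertexSet]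
  exact_mod_cast hn

end IsBicyclic

/-! ### The excess of the degrees over a core -/

open Classical in
/-- The degree in `D` of the vertices of `D`, and `1` at all other vertices. -/
noncomputable def coreDegree {α : Type*} (D : Hypergraph α) (v : α) : ℕ :=
  if v ∈ D.vertexSet then D.degree v else 1

/-- `D` is a subhypergraph of `H` that has `c` edges and the vertex number of a bicyclic
hypergraph. -/
structure IsCore {α : Type*} (D H : Hypergraph α) (k c : ℕ) : Prop where
  vertexSet_subset : D.vertexSet ⊆ H.vertexSet
  edgeSet_subset : D.edgeSet ⊆ H.edgeSet
  ncard_vertexSet : D.vertexSet.ncard + 1 = c * (k - 1)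
  ncard_edgeSet : D.edgeSet.ncard = c

namespace IsCore

variable {α : Type*} {D H : Hypergraph α} {k n m c : ℕ}

theorem coreDegree_le (hD : D.IsCore H k c) (h : H.IsBicyclic k n m) (hn : 2 ≤ n)
    {v : α} (hv : v ∈ H.vertexSet) : D.coreDegree v ≤ H.degree v := by
  rw [coreDegree]
  split_ifs
  · exact degree_le_degree h.finite_edgeSet hD.edgeSet_subset v
  · exact h.one_le_degree hn hv

theorem le_card (hD : D.IsCore H k c) (h : H.IsBicyclic k n m) : c ≤ m := by
  rw [← hD.ncard_edgeSet, ← h.ncard_edgeSet]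
  exact Set.ncard_le_ncard hD.edgeSet_subset h.finite_edgeSet

/-- Core and hypergraph both have one vertex less than `k - 1` times their number of edges;
subtracting the two relations counts the vertices outside the core. -/
theorem card_add (hD : D.IsCore H k c) (h : H.IsBicyclic k n m) (hk : 1 ≤ k) :
    n = D.vertexSet.ncard + (m - c) * (k - 1) := by
  have h1 := hD.ncard_vertexSet
  have h2 := h.bicyclic
  obtain ⟨s, rfl⟩ := Nat.exists_eq_add_of_le (hD.le_card h)
  obtain ⟨K, rfl⟩ := Nat.exists_eq_add_of_le' hk
  rw [Nat.add_sub_cancel_left, Nat.add_sub_cancel] at *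
  zify at *
  linarith

theorem sum_ite (hD : D.IsCore H k c) (h : H.IsBicyclic k n m) (hk : 1 ≤ k) (f : α → ℕ)
    [DecidablePred (· ∈ D.vertexSet)] :
    ∑ v ∈ h.finite_vertexSet.toFinset, (if v ∈ D.vertexSet then f v else 1) =
      ∑ v ∈ (h.finite_vertexSet.subset hD.vertexSet_subset).toFinset, f v +
        (m - c) * (k - 1) := by
  classical
  have hsub : (h.finite_vertexSet.subset hD.vertexSet_subset).toFinset ⊆
      h.finite_vertexSet.toFinset := by
    simpa using hD.vertexSet_subset
  rw [← Finset.sum_sdiff hsub, add_comm]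
  congr 1
  · exact Finset.sum_congr rfl fun v hv => if_pos (by simpa using hv)
  · rw [Finset.sum_congr rfl (g := fun _ => 1)
      (fun v hv => if_neg (by have := (Finset.mem_sdiff.1 hv).2; simpa using this)),
      Finset.sum_const, smul_eq_mul, mul_one, Finset.card_sdiff_of_subset hsub,
      ← Set.ncard_eq_toFinset_card _ h.finite_vertexSet, ← Set.ncard_eq_toFinset_card _
        (h.finite_vertexSet.subset hD.vertexSet_subset), h.ncard_vertexSet,
      hD.card_add h hk, Nat.add_sub_cancel_left]

theorem sum_coreDegree_sq (hD : D.IsCore H k c) (h : H.IsBicyclic k n m) (hk : 1 ≤ k) :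
    ∑ v ∈ h.finite_vertexSet.toFinset, D.coreDegree v ^ 2 =
      D.zagreb + (m - c) * (k - 1) := by
  classical
  rw [D.zagreb_eq_sum (h.finite_vertexSet.subset hD.vertexSet_subset),
    ← hD.sum_ite h hk (fun v => D.degree v ^ 2)]
  refine Finset.sum_congr rfl fun v _ => ?_
  rw [coreDegree]
  split_ifs <;> simp

theorem sum_coreDegree (hD : D.IsCore H k c) (h : H.IsBicyclic k n m) (hk : 1 ≤ k) :
    ∑ v ∈ h.finite_vertexSet.toFinset, D.coreDegree v = c * k + (m - c) * (k - 1) := by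
  classical
  rw [← hD.ncard_edgeSet, ← sum_degree D (h.finite_vertexSet.subset hD.vertexSet_subset)
    (h.finite_edgeSet.subset hD.edgeSet_subset) (fun e he => h.uniform e (hD.edgeSet_subset he)),
    hD.ncard_edgeSet, ← hD.sum_ite h hk D.degree]
  refine Finset.sum_congr rfl fun v _ => ?_
  rw [coreDegree]

/-- The degrees of `H` sum to `m * k` and the core degrees to `c * k + (m - c) * (k - 1)`, so one
unit of excess remains for each edge outside the core. -/
theorem sum_sub (hD : D.IsCore H k c) (h : H.IsBicyclic k n m) (hk : 1 ≤ k) (hn : 2 ≤ n) :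
    ∑ v ∈ h.finite_vertexSet.toFinset, (H.degree v - D.coreDegree v) = m - c := by
  have h1 : ∑ v ∈ h.finite_vertexSet.toFinset, H.degree v =
      ∑ v ∈ h.finite_vertexSet.toFinset, D.coreDegree v +
        ∑ v ∈ h.finite_vertexSet.toFinset, (H.degree v - D.coreDegree v) := by
    rw [← Finset.sum_add_distrib]
    refine Finset.sum_congr rfl fun v hv => ?_
    have := hD.coreDegree_le h hn (v := v) (by simpa using hv)
    omega
  rw [hD.sum_coreDegree h hk, sum_degree H h.finite_vertexSet h.finite_edgeSet h.uniform,
    h.ncard_edgeSet] at h1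
  have h2 := hD.le_card h
  obtain ⟨s, rfl⟩ := Nat.exists_eq_add_of_le h2
  obtain ⟨K, rfl⟩ := Nat.exists_eq_add_of_le' hk
  simp only [Nat.add_sub_cancel_left, Nat.add_sub_cancel] at *
  nlinarith

theorem zagreb_eq (hD : D.IsCore H k c) (h : H.IsBicyclic k n m) (hn : 2 ≤ n) :
    H.zagreb = ∑ v ∈ h.finite_vertexSet.toFinset,
      (D.coreDegree v + (H.degree v - D.coreDegree v)) ^ 2 := by
  rw [H.zagreb_eq_sum h.finite_vertexSet]
  refine Finset.sum_congr rfl fun v hv => ?_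
  have := hD.coreDegree_le h hn (v := v) (by simpa using hv)
  rw [Nat.add_sub_cancel' this]

theorem coreDegree_le_of_degree_le {B : ℕ} (hB : 1 ≤ B) (hdeg : ∀ v ∈ D.vertexSet, D.degree v ≤ B)
    (v : α) : D.coreDegree v ≤ B := by
  rw [coreDegree]
  split_ifs with hv
  · exact hdeg v hv
  · exact hB

theorem zagreb_le (hD : D.IsCore H k c) (h : H.IsBicyclic k n m) (hk : 1 ≤ k) (hn : 2 ≤ n)
    {B : ℕ} (hB : 1 ≤ B) (hdeg : ∀ v ∈ D.vertexSet, D.degree v ≤ B) :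
    H.zagreb ≤ D.zagreb + (m - c) * (k - 1) + 2 * B * (m - c) + (m - c) ^ 2 := by
  have := sum_sq_add_le h.finite_vertexSet.toFinset D.coreDegree
    (fun v => H.degree v - D.coreDegree v) B
    (fun v _ => coreDegree_le_of_degree_le hB hdeg v)
  rwa [← hD.zagreb_eq h hn, hD.sum_coreDegree_sq h hk, hD.sum_sub h hk hn] at this

-- Equality in `zagreb_le` puts all the excess on a single vertex. If `m = c` there is no excess,
-- and any vertex of degree `B` serves; this is the only use of `hex`.
open Classical in
theorem degree_of_zagreb_eq (hD : D.IsCore H k c) (h : H.IsBicyclic k n m) (hk : 1 ≤ k)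
    (hn : 2 ≤ n) {B : ℕ} (hB : 2 ≤ B) (hdeg : ∀ v ∈ D.vertexSet, D.degree v ≤ B)
    (hex : ∃ v ∈ D.vertexSet, D.degree v = B)
    (heq : H.zagreb = D.zagreb + (m - c) * (k - 1) + 2 * B * (m - c) + (m - c) ^ 2) :
    ∃ v ∈ D.vertexSet, D.degree v = B ∧
      ∀ w ∈ H.vertexSet, H.degree w = D.coreDegree w + if w = v then m - c else 0 := by
  have hdeg' := fun v => coreDegree_le_of_degree_le (D := D) (by omega : 1 ≤ B) hdeg v
  have hsum := hD.sum_sub h hk hn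
  have key := eq_of_sum_sq_add_eq h.finite_vertexSet.toFinset D.coreDegree
    (fun v => H.degree v - D.coreDegree v) B (fun v _ => hdeg' v)
    (by rw [← hD.zagreb_eq h hn, hD.sum_coreDegree_sq h hk, hsum, heq])
  rw [hsum] at key
  by_cases hs : m - c = 0
  · obtain ⟨v, hv, hvB⟩ := hex
    refine ⟨v, hv, hvB, fun w hw => ?_⟩
    rw [hs] at hsum
    have h1 := (Finset.sum_eq_zero_iff.1 hsum) w (by simpa using hw)
    have h2 := hD.coreDegree_le h hn hw
    rw [hs, ite_self]
    omega
  · obtain ⟨v, hv, hv0⟩ := Finset.exists_ne_zero_of_sum_ne_zero (hsum ▸ hs)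
    obtain ⟨h1, h2⟩ := key v hv hv0
    -- Outside `D` the core degree is `1`, which is less than `B`.
    have hvD : v ∈ D.vertexSet := by
      by_contra hvD
      rw [coreDegree, if_neg hvD] at h1
      omega
    refine ⟨v, hvD, by rwa [coreDegree, if_pos hvD] at h1, fun w hw => ?_⟩
    have h3 := hD.coreDegree_le h hn hw
    split_ifs with hwv
    · subst hwv; omega
    · have h4 : H.degree w - D.coreDegree w = 0 := by
        have h5 := Finset.add_sum_erase _ (fun v => H.degree v - D.coreDegree v) hv
        have h6 : H.degree w - D.coreDegree w ≤
            ∑ x ∈ h.finite_vertexSet.toFinset.erase v, (H.degree x - D.coreDegree x) :=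
          Finset.single_le_sum (f := fun x => H.degree x - D.coreDegree x)
            (fun _ _ => Nat.zero_le _) (Finset.mem_erase.2 ⟨hwv, by simpa using hw⟩)
        omega
      omega

end IsCore

/-! ### Invariance under injective maps -/

theorem injOn_image_edgeSet {α β : Type*} (C : Hypergraph β) {f : β → α}
    (hf : C.vertexSet.InjOn f) : C.edgeSet.InjOn (Set.image f) := by
  intro e he e' he' h
  have h1 := C.subset_vertexSet_of_mem_edgeSet he
  have h2 := C.subset_vertexSet_of_mem_edgeSet he'
  exact (hf.image_eq_image_iff h1 h2).1 h

theorem degree_image {α β : Type*} (C : Hypergraph β) {f : β → α}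
    (hf : C.vertexSet.InjOn f) {b : β} (hb : b ∈ C.vertexSet) :
    (C.image f).degree (f b) = C.degree b := by
  have : {e | e ∈ (C.image f).edgeSet ∧ f b ∈ e} =
      Set.image f '' {e | e ∈ C.edgeSet ∧ b ∈ e} := by
    ext e
    constructor
    · rintro ⟨⟨e', he', rfl⟩, y, hy, hyb⟩
      have := hf (C.mem_vertexSet_of_mem_edgeSet he' hy) hb hyb
      exact ⟨e', ⟨he', this ▸ hy⟩, rfl⟩
    · rintro ⟨e', ⟨he', hb'⟩, rfl⟩
      exact ⟨⟨e', he', rfl⟩, b, hb', rfl⟩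
  rw [degree, this, degree]
  exact ((C.injOn_image_edgeSet hf).mono fun e he => he.1).ncard_image

theorem zagreb_image {α β : Type*} (C : Hypergraph β) {f : β → α}
    (hf : C.vertexSet.InjOn f) : (C.image f).zagreb = C.zagreb := by
  unfold zagreb
  rw [image_vertexSet, finsum_mem_image hf]
  exact finsum_mem_congr rfl fun b hb => by rw [C.degree_image hf hb]

theorem ncard_edgeSet_image {α β : Type*} (C : Hypergraph β) {f : β → α}
    (hf : C.vertexSet.InjOn f) : (C.image f).edgeSet.ncard = C.edgeSet.ncard :=
  (C.injOn_image_edgeSet hf).ncard_image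

theorem ncard_vertexSet_image {α β : Type*} (C : Hypergraph β) {f : β → α}
    (hf : C.vertexSet.InjOn f) : (C.image f).vertexSet.ncard = C.vertexSet.ncard :=
  hf.ncard_image

theorem HasHypercycle.image {α β : Type*} {C : Hypergraph β} {f : β → α}
    (hf : C.vertexSet.InjOn f) {L : ℕ} (h : C.HasHypercycle L) :
    (C.image f).HasHypercycle L := by
  obtain ⟨hL, x, e, hx, he, h⟩ := h
  refine ⟨hL, f ∘ x, fun i => f '' e i, fun i hi j hj hij => ?_, fun i hi j hj hij => ?_,
    fun i hi => ⟨⟨e i, (h i hi).1, rfl⟩, ⟨_, (h i hi).2.1, rfl⟩, ⟨_, (h i hi).2.2, rfl⟩⟩⟩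
  · exact hx hi hj (hf (C.mem_vertexSet_of_mem_edgeSet (h i hi).1 (h i hi).2.1)
      (C.mem_vertexSet_of_mem_edgeSet (h j hj).1 (h j hj).2.1) hij)
  · exact he hi hj (C.injOn_image_edgeSet hf (h i hi).1 (h j hj).1 hij)

theorem HasHypercycle.mono {α : Type*} {D H : Hypergraph α} (hDE : D.edgeSet ⊆ H.edgeSet) {L : ℕ}
    (h : D.HasHypercycle L) : H.HasHypercycle L := by
  obtain ⟨hL, x, e, hx, he, h⟩ := h
  exact ⟨hL, x, e, hx, he, fun i hi => ⟨hDE (h i hi).1, (h i hi).2⟩⟩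

/-! ### Recognising attached pendant edges -/

theorem encard_Iio (t : ℕ) : (Set.Iio t).encard = t := by
  rw [← Finset.coe_range, Set.encard_coe_eq_coe_finsetCard, Finset.card_range]

/-- If every edge of `H` outside a copy of `C` consists of one vertex of the copy, always the same,
and of vertices that lie in no other edge, then `H` arises from `C` by attaching pendant edges. -/
theorem isIso_attachPendant {α β : Type*} {C : Hypergraph β} {H : Hypergraph α} {f : β → α}
    (hf : C.vertexSet.InjOn f) {x : β} (hx : x ∈ C.vertexSet) {k s : ℕ}
    (hV : f '' C.vertexSet ⊆ H.vertexSet) (hE : (C.image f).edgeSet ⊆ H.edgeSet)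
    (hs : (H.edgeSet \ (C.image f).edgeSet).encard = s)
    (hmem : ∀ e ∈ H.edgeSet \ (C.image f).edgeSet, f x ∈ e)
    (hcard : ∀ e ∈ H.edgeSet, e.encard = k)
    (hdisj : ∀ e ∈ H.edgeSet \ (C.image f).edgeSet, ∀ w ∈ f '' C.vertexSet, w ∈ e → w = f x)
    (huniq : ∀ w ∈ H.vertexSet \ f '' C.vertexSet, ∃! e, e ∈ H.edgeSet ∧ w ∈ e) :
    (C.attachPendant x k s).IsIso H := by
  have hfin : (Set.Iio s).Finite := Set.finite_Iio s
  obtain ⟨g, hg⟩ := hfin.exists_bijOn_of_encard_eq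
    (t := H.edgeSet \ (C.image f).edgeSet) (by rw [hs, encard_Iio])
  have hgm : ∀ i < s, g i ∈ H.edgeSet \ (C.image f).edgeSet := fun i hi => hg.mapsTo hi
  -- `g` numbers the edges outside the copy, and `r i` the `k - 1` vertices of `g i` other than `f
  -- x`. For `i ≥ s` the choice of `r i` is irrelevant.
  have hex : ∀ i, ∃ r : ℕ → α, i < s → Set.BijOn r (Set.Iio (k - 1)) (g i \ {f x}) := by
    intro i
    by_cases hi : i < s
    · have : Nonempty α := ⟨f x⟩
      obtain ⟨r, hr⟩ := (Set.finite_Iio (k - 1)).exists_bijOn_of_encard_eq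
        (t := g i \ {f x}) (by
          rw [Set.encard_sdiff_singleton_of_mem (hmem _ (hgm i hi)), hcard _ (hgm i hi).1, encard_Iio]
          norm_cast)
      exact ⟨r, fun _ => hr⟩
    · exact ⟨fun _ => f x, fun h => absurd h hi⟩
  choose r hr using hex
  have hrm : ∀ i < s, ∀ j < k - 1, r i j ∈ g i ∧ r i j ≠ f x := fun i hi j hj => (hr i hi).mapsTo hj
  have hrV : ∀ i < s, ∀ j < k - 1, r i j ∈ H.vertexSet \ f '' C.vertexSet := fun i hi j hj =>
    ⟨H.mem_vertexSet_of_mem_edgeSet (hgm i hi).1 (hrm i hi j hj).1, fun hc =>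
      (hrm i hi j hj).2 (hdisj _ (hgm i hi) _ hc (hrm i hi j hj).1)⟩
  have hedge : ∀ i < s, Sum.elim f (fun y : ℕ × ℕ => r y.1 y.2) ''
      insert (Sum.inl x) (Sum.inr '' ({i} ×ˢ Set.Iio (k - 1))) = g i := by
    intro i hi
    rw [Set.image_insert_eq, Set.image_image]
    simp only [Sum.elim_inl, Sum.elim_inr]
    have : (fun y : ℕ × ℕ => r y.1 y.2) '' ({i} ×ˢ Set.Iio (k - 1)) = g i \ {f x} := by
      rw [← (hr i hi).image_eq]
      ext w
      simp
    rw [this, Set.insert_sdiff_singleton, Set.insert_eq_of_mem (hmem _ (hgm i hi))]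
  refine ⟨Sum.elim f (fun y => r y.1 y.2), ?_, ?_⟩
  · rintro (a | ⟨i, j⟩) ha (b | ⟨i', j'⟩) hb hab
    · simp only [attachPendant, Set.insert_eq_of_mem hx, Set.mem_union, Set.mem_image,
        Sum.inl.injEq, exists_eq_right, reduceCtorEq, and_false, exists_false, or_false] at ha hb
      rw [hf ha hb hab]
    · simp only [attachPendant, Set.insert_eq_of_mem hx, Set.mem_union, Set.mem_image,
        Sum.inl.injEq, Sum.inr.injEq, exists_eq_right, reduceCtorEq, and_false, exists_false,
        or_false, false_or, Set.mem_prod, Set.mem_Iio] at ha hb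
      exact absurd ⟨a, ha, hab⟩ (hrV i' hb.1 j' hb.2).2
    · simp only [attachPendant, Set.insert_eq_of_mem hx, Set.mem_union, Set.mem_image,
        Sum.inl.injEq, Sum.inr.injEq, exists_eq_right, reduceCtorEq, and_false, exists_false,
        or_false, false_or, Set.mem_prod, Set.mem_Iio] at ha hb
      exact absurd ⟨b, hb, hab.symm⟩ (hrV i ha.1 j ha.2).2
    · simp only [attachPendant, Set.insert_eq_of_mem hx, Set.mem_union, Set.mem_image,
        Sum.inr.injEq, exists_eq_right, reduceCtorEq, and_false, exists_false,
        false_or, Set.mem_prod, Set.mem_Iio] at ha hb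
      simp only [Sum.elim_inr] at hab
      -- Two outside edges cannot share a new vertex, so the numberings of different edges have
      -- disjoint images.
      have h1 : g i = g i' := (huniq _ (hrV i ha.1 j ha.2)).unique
        ⟨(hgm i ha.1).1, (hrm i ha.1 j ha.2).1⟩
        ⟨(hgm i' hb.1).1, hab ▸ (hrm i' hb.1 j' hb.2).1⟩
      obtain rfl := hg.injOn ha.1 hb.1 h1
      rw [(hr i ha.1).injOn ha.2 hb.2 hab]
  · refine Hypergraph.ext (Set.Subset.antisymm ?_ ?_) (Set.Subset.antisymm ?_ ?_)
    · rintro w ⟨y | ⟨i, j⟩, hy, rfl⟩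
      · simp only [attachPendant, Set.insert_eq_of_mem hx, Set.mem_union, Set.mem_image,
          Sum.inl.injEq, exists_eq_right, reduceCtorEq, and_false, exists_false, or_false] at hy
        exact hV ⟨y, hy, rfl⟩
      · simp only [attachPendant, Set.mem_union, Set.mem_image,
          Sum.inr.injEq, exists_eq_right, reduceCtorEq, and_false, exists_false,
          false_or, Set.mem_prod, Set.mem_Iio] at hy
        exact (hrV i hy.1 j hy.2).1
    · intro w hw
      by_cases hwC : w ∈ f '' C.vertexSet
      · obtain ⟨y, hy, rfl⟩ := hwC
        exact ⟨Sum.inl y, Or.inl ⟨y, Or.inr hy, rfl⟩, rfl⟩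
      · obtain ⟨e, ⟨he, hwe⟩, -⟩ := huniq w ⟨hw, hwC⟩
        have heD : e ∉ (C.image f).edgeSet := fun h =>
          hwC ((C.image f).mem_vertexSet_of_mem_edgeSet h hwe)
        obtain ⟨i, hi, rfl⟩ := hg.surjOn ⟨he, heD⟩
        have hne : w ≠ f x := fun h => hwC ⟨x, hx, h.symm⟩
        obtain ⟨j, hj, rfl⟩ := (hr i hi).surjOn ⟨hwe, hne⟩
        exact ⟨Sum.inr (i, j), Or.inr ⟨(i, j), ⟨hi, hj⟩, rfl⟩, rfl⟩
    · rintro e ⟨e', ⟨e', he', rfl⟩ | ⟨i, hi, rfl⟩, rfl⟩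
      · refine hE ⟨e', he', ?_⟩
        rw [Set.image_image]
        rfl
      · rw [hedge i hi]
        exact (hgm i hi).1
    · intro e he
      by_cases heD : e ∈ (C.image f).edgeSet
      · obtain ⟨e', he', rfl⟩ := heD
        refine ⟨Sum.inl '' e', Or.inl ⟨e', he', rfl⟩, ?_⟩
        rw [Set.image_image]
        rfl
      · obtain ⟨i, hi, rfl⟩ := hg.surjOn ⟨he, heD⟩
        exact ⟨_, Or.inr ⟨i, hi, rfl⟩, hedge i hi⟩

-- The degrees determine how the further edges are placed: a core vertex other than `f x` has no
-- degree left for them, and a vertex outside the core lies in only one edge.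
open Classical in
theorem isIso_attachPendant_of_degree {α β : Type*} {C : Hypergraph β} {H : Hypergraph α}
    {f : β → α} (hf : C.vertexSet.InjOn f) {x : β} (hx : x ∈ C.vertexSet) {k n m c : ℕ}
    (hD : (C.image f).IsCore H k c) (h : H.IsBicyclic k n m)
    (hdeg : ∀ w ∈ H.vertexSet,
      H.degree w = (C.image f).coreDegree w + if w = f x then m - c else 0) :
    (C.attachPendant x k (m - c)).IsIso H := by
  have hfin := h.finite_edgeSet
  have hcardE : (H.edgeSet \ (C.image f).edgeSet).ncard = m - c := by
    rw [Set.ncard_sdiff hD.edgeSet_subset (hfin.subset hD.edgeSet_subset), h.ncard_edgeSet,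
      hD.ncard_edgeSet]
  have hsub : ∀ w, {e | e ∈ (C.image f).edgeSet ∧ w ∈ e} ⊆ {e | e ∈ H.edgeSet ∧ w ∈ e} :=
    fun w e he => ⟨hD.edgeSet_subset he.1, he.2⟩
  have hfinw : ∀ w, {e | e ∈ H.edgeSet ∧ w ∈ e}.Finite := fun w => hfin.subset fun e he => he.1
  have hxV : f x ∈ (C.image f).vertexSet := ⟨x, hx, rfl⟩
  refine isIso_attachPendant hf hx hD.vertexSet_subset hD.edgeSet_subset ?_ ?_ h.uniform ?_ ?_
  · rw [← hcardE, Set.Finite.cast_ncard_eq (hfin.subset Set.sdiff_subset)]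
  · have h1 := hdeg (f x) (hD.vertexSet_subset hxV)
    rw [if_pos rfl, coreDegree, if_pos hxV, degree, degree] at h1
    have h2 := Set.ncard_sdiff (hsub (f x)) ((hfinw (f x)).subset (hsub (f x)))
    -- The degree of `f x` exceeds its core degree by `m - c`, which is the number of all edges
    -- outside the copy, so each of them passes through `f x`.
    have h3 : {e | e ∈ H.edgeSet ∧ f x ∈ e} \ {e | e ∈ (C.image f).edgeSet ∧ f x ∈ e} =
        H.edgeSet \ (C.image f).edgeSet := by
      refine Set.eq_of_subset_of_ncard_le ?_ ?_ (hfin.subset Set.sdiff_subset)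
      · exact fun e he => ⟨he.1.1, fun hc => he.2 ⟨hc, he.1.2⟩⟩
      · omega
    intro e he
    rw [← h3] at he
    exact he.1.2
  · intro e he w hw hwe
    by_contra hne
    have h1 := hdeg w (hD.vertexSet_subset hw)
    rw [if_neg hne, add_zero, coreDegree, if_pos (show w ∈ (C.image f).vertexSet from hw),
      degree, degree] at h1
    have h2 := Set.eq_of_subset_of_ncard_le (hsub w) h1.le (hfinw w)
    have h3 : e ∈ {e | e ∈ H.edgeSet ∧ w ∈ e} := ⟨he.1, hwe⟩
    rw [← h2] at h3
    exact he.2 h3.1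
  · intro w hw
    have hne : w ≠ f x := fun hc => hw.2 (hc ▸ hxV)
    have h1 := hdeg w hw.1
    rw [if_neg hne, add_zero, coreDegree, if_neg (show w ∉ (C.image f).vertexSet from hw.2),
      degree, Set.ncard_eq_one] at h1
    obtain ⟨e, he⟩ := h1
    refine ⟨e, ?_, fun e' he' => ?_⟩
    · exact he.symm.subset rfl
    · exact he.subset he'

/-! ### Hypergraphs with pendant edges -/

section Attach

variable {β : Type*} (C : Hypergraph β) (x : β) (k t : ℕ)

theorem mem_vertexSet_attachPendant_inl {x : β} (hx : x ∈ C.vertexSet) (b : β) :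
    Sum.inl b ∈ (C.attachPendant x k t).vertexSet ↔ b ∈ C.vertexSet := by
  simp [attachPendant, Set.insert_eq_of_mem hx]

theorem mem_vertexSet_attachPendant_inr (y : ℕ × ℕ) :
    Sum.inr y ∈ (C.attachPendant x k t).vertexSet ↔ y.1 < t ∧ y.2 < k - 1 := by
  simp [attachPendant]

theorem vertexSet_image_inl_subset : (C.image Sum.inl).vertexSet ⊆
    (C.attachPendant x k t).vertexSet := by
  rintro _ ⟨b, hb, rfl⟩
  exact Or.inl ⟨b, Or.inr hb, rfl⟩

theorem edgeSet_image_inl_subset : (C.image Sum.inl).edgeSet ⊆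
    (C.attachPendant x k t).edgeSet := Set.subset_union_left

theorem attachPendant_containsCopy : (C.attachPendant x k t).ContainsCopy C :=
  ⟨Sum.inl, Sum.inl_injective.injOn, C.vertexSet_image_inl_subset x k t,
    C.edgeSet_image_inl_subset x k t⟩

/-- The `s`-th pendant edge of `C.attachPendant x k t`. -/
def pendantEdge (s : ℕ) : Set (β ⊕ ℕ × ℕ) :=
  insert (Sum.inl x) (Sum.inr '' ({s} ×ˢ Set.Iio (k - 1)))

variable {x k}

theorem mem_pendantEdge_inl {b : β} {s : ℕ} : Sum.inl b ∈ pendantEdge x k s ↔ b = x := by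
  simp [pendantEdge]

theorem mem_pendantEdge_inr {y : ℕ × ℕ} {s : ℕ} :
    Sum.inr y ∈ pendantEdge x k s ↔ y.1 = s ∧ y.2 < k - 1 := by
  simp only [pendantEdge, Set.mem_insert_iff, reduceCtorEq, Set.mem_image, Sum.inr.injEq,
    exists_eq_right, false_or, Set.mem_prod, Set.mem_singleton_iff, Set.mem_Iio]

theorem pendantEdge_injective (hk : 2 ≤ k) : Function.Injective (pendantEdge x k) := by
  intro s s' h
  have : Sum.inr (s, 0) ∈ pendantEdge x k s := mem_pendantEdge_inr.2 ⟨rfl, by simp; omega⟩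
  rw [h] at this
  exact (mem_pendantEdge_inr.1 this).1

theorem pendantEdge_not_mem (hk : 2 ≤ k) (s : ℕ) (e : Set β) :
    pendantEdge x k s ≠ Sum.inl '' e := by
  intro h
  have : Sum.inr (s, 0) ∈ pendantEdge x k s := mem_pendantEdge_inr.2 ⟨rfl, by simp; omega⟩
  rw [h] at this
  obtain ⟨b, -, hb⟩ := this
  exact absurd hb (by simp)

variable {t}

theorem mem_edgeSet_attachPendant {e : Set (β ⊕ ℕ × ℕ)} :
    e ∈ (C.attachPendant x k t).edgeSet ↔
      (∃ e' ∈ C.edgeSet, Sum.inl '' e' = e) ∨ ∃ s < t, e = pendantEdge x k s := Iff.rfl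

theorem encard_pendantEdge (hk : 1 ≤ k) (s : ℕ) : (pendantEdge x k s).encard = k := by
  rw [pendantEdge, Set.encard_insert_of_notMem (by simp), Sum.inr_injective.encard_image,
    Set.encard_prod, Set.encard_singleton, one_mul, encard_Iio]
  norm_cast
  omega

theorem vertexSet_attachPendant (hx : x ∈ C.vertexSet) : (C.attachPendant x k t).vertexSet =
    Sum.inl '' C.vertexSet ∪ Sum.inr '' (Set.Iio t ×ˢ Set.Iio (k - 1)) := by
  conv_rhs => rw [← Set.insert_eq_of_mem hx]
  rfl

theorem encard_edgeSet_attachPendant (hk : 2 ≤ k) :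
    (C.attachPendant x k t).edgeSet.encard = C.edgeSet.encard + t := by
  have : (C.attachPendant x k t).edgeSet =
      Set.image Sum.inl '' C.edgeSet ∪ pendantEdge x k '' Set.Iio t := by
    ext e
    rw [mem_edgeSet_attachPendant]
    simp [eq_comm]
  rw [this, Set.encard_union_eq, (pendantEdge_injective hk).encard_image,
    Sum.inl_injective.image_injective.encard_image]
  · rw [encard_Iio]
  · rw [Set.disjoint_left]
    rintro _ ⟨e, he, rfl⟩ ⟨s, -, hs⟩
    exact pendantEdge_not_mem hk s e hs

theorem encard_vertexSet_attachPendant (hx : x ∈ C.vertexSet) :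
    (C.attachPendant x k t).vertexSet.encard = C.vertexSet.encard + t * (k - 1 : ℕ) := by
  rw [C.vertexSet_attachPendant hx, Set.encard_union_eq, Sum.inl_injective.encard_image,
    Sum.inr_injective.encard_image, Set.encard_prod]
  · rw [encard_Iio, encard_Iio]
  · rw [Set.disjoint_left]
    rintro _ ⟨e, he, rfl⟩ ⟨s, -, hs⟩
    simp at hs

theorem IsUniform.attachPendant (hC : C.IsUniform k) (hk : 1 ≤ k) :
    (C.attachPendant x k t).IsUniform k := by
  rintro e (⟨e', he', rfl⟩ | ⟨s, hs, rfl⟩)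
  · rw [Sum.inl_injective.encard_image]
    exact hC e' he'
  · exact encard_pendantEdge hk s

theorem isConnected_of_forall_reaches {α : Type*} {H : Hypergraph α} {v : α}
    (hv : v ∈ H.vertexSet)
    (h : ∀ w ∈ H.vertexSet, Relation.ReflTransGen H.Adj w v) : H.IsConnected := by
  refine ⟨⟨v, hv⟩, fun a ha b hb => (h a ha).trans ?_⟩
  have : Std.Symm H.Adj := ⟨fun _ _ h => h.symm⟩
  exact symm (h b hb)

theorem IsConnected.attachPendant (hC : C.IsConnected) (hx : x ∈ C.vertexSet) :
    (C.attachPendant x k t).IsConnected := by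
  refine isConnected_of_forall_reaches (v := Sum.inl x)
    ((C.mem_vertexSet_attachPendant_inl k t hx x).2 hx) ?_
  rintro (b | y) hb
  · rw [mem_vertexSet_attachPendant_inl C k t hx] at hb
    refine (hC.2 b hb x hx).lift Sum.inl fun u w huw => ?_
    obtain ⟨e, he, hu, hw⟩ := huw
    exact ⟨Sum.inl '' e, Or.inl ⟨e, he, rfl⟩, ⟨u, hu, rfl⟩, ⟨w, hw, rfl⟩⟩
  · rw [mem_vertexSet_attachPendant_inr] at hb
    exact .single ⟨pendantEdge x k y.1, Or.inr ⟨y.1, hb.1, rfl⟩,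
      mem_pendantEdge_inr.2 ⟨rfl, hb.2⟩, mem_pendantEdge_inl.2 rfl⟩

open Classical in
theorem degree_attachPendant_inl (hE : C.edgeSet.Finite) (hk : 2 ≤ k) (b : β) :
    (C.attachPendant x k t).degree (Sum.inl b) = C.degree b + if b = x then t else 0 := by
  have : {e | e ∈ (C.attachPendant x k t).edgeSet ∧ Sum.inl b ∈ e} =
      Set.image Sum.inl '' {e | e ∈ C.edgeSet ∧ b ∈ e} ∪
        pendantEdge x k '' (if b = x then Set.Iio t else ∅) := by
    ext e
    simp only [Set.mem_ofPred_eq, mem_edgeSet_attachPendant, Set.mem_union, Set.mem_image]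
    constructor
    · rintro ⟨⟨e', he', rfl⟩ | ⟨s, hs, rfl⟩, hb⟩
      · exact Or.inl ⟨e', ⟨he', by simpa using hb⟩, rfl⟩
      · rw [mem_pendantEdge_inl] at hb
        exact Or.inr ⟨s, by simpa [hb] using hs, rfl⟩
    · rintro (⟨e', ⟨he', hb⟩, rfl⟩ | ⟨s, hs, rfl⟩)
      · exact ⟨Or.inl ⟨e', he', rfl⟩, b, hb, rfl⟩
      · split_ifs at hs with hbx
        · exact ⟨Or.inr ⟨s, hs, rfl⟩, mem_pendantEdge_inl.2 hbx⟩
        · exact absurd hs (Set.notMem_empty s)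
  rw [degree, this, Set.ncard_union_eq ?_ ?_ ?_, Set.ncard_image_of_injective _ (pendantEdge_injective hk),
    Set.ncard_image_of_injective _ Sum.inl_injective.image_injective]
  · rw [degree]
    congr 1
    split_ifs
    · rw [Set.ncard, encard_Iio]; rfl
    · simp
  · rw [Set.disjoint_left]
    rintro _ ⟨e, he, rfl⟩ ⟨s, -, hs⟩
    exact pendantEdge_not_mem hk s e hs
  · exact (hE.subset fun e he => he.1).image _
  · refine Set.Finite.image _ ?_
    split_ifs
    · exact Set.finite_Iio t
    · exact Set.finite_empty

theorem degree_attachPendant_inr {y : ℕ × ℕ} (hy1 : y.1 < t) (hy2 : y.2 < k - 1) :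
    (C.attachPendant x k t).degree (Sum.inr y) = 1 := by
  rw [degree, Set.ncard_eq_one]
  refine ⟨pendantEdge x k y.1, ?_⟩
  ext e
  simp only [Set.mem_ofPred_eq, mem_edgeSet_attachPendant, Set.mem_singleton_iff]
  constructor
  · rintro ⟨⟨e', he', rfl⟩ | ⟨s, hs, rfl⟩, hb⟩
    · simp at hb
    · rw [(mem_pendantEdge_inr.1 hb).1]
  · rintro rfl
    exact ⟨Or.inr ⟨_, hy1, rfl⟩, mem_pendantEdge_inr.2 ⟨rfl, hy2⟩⟩

/-- The pendant edges add `t * (k - 1)` vertices of degree one and raise the degree of `x` by `t`.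
The value is the bound of `IsCore.zagreb_le` with `B` the degree of `x`. -/
theorem zagreb_attachPendant (hV : C.vertexSet.Finite) (hE : C.edgeSet.Finite) (hk : 2 ≤ k)
    (hx : x ∈ C.vertexSet) :
    (C.attachPendant x k t).zagreb =
      C.zagreb + t * (k - 1) + 2 * C.degree x * t + t ^ 2 := by
  classical
  have hfin : (Set.Iio t ×ˢ Set.Iio (k - 1)).Finite :=
    (Set.finite_Iio t).prod (Set.finite_Iio (k - 1))
  rw [zagreb, C.vertexSet_attachPendant hx, finsum_mem_union, finsum_mem_image Sum.inl_injective.injOn,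
    finsum_mem_image Sum.inr_injective.injOn]
  · have h2 : ∑ᶠ y ∈ Set.Iio t ×ˢ Set.Iio (k - 1),
        (C.attachPendant x k t).degree (Sum.inr y) ^ 2 = t * (k - 1) := by
      rw [finsum_mem_congr rfl (g := fun _ => 1) fun y hy => by
        rw [C.degree_attachPendant_inr hy.1 hy.2, one_pow], finsum_mem_eq_finite_toFinset_sum _ hfin,
        Finset.sum_const, ← Set.ncard_eq_toFinset_card _ hfin, smul_eq_mul, mul_one,
        Set.ncard_prod, Set.ncard, Set.ncard, encard_Iio, encard_Iio]
      rfl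
    have h1 : ∑ᶠ b ∈ C.vertexSet, (C.attachPendant x k t).degree (Sum.inl b) ^ 2 =
        C.zagreb + 2 * C.degree x * t + t ^ 2 := by
      rw [C.zagreb_eq_sum hV, finsum_mem_eq_finite_toFinset_sum _ hV]
      have hx' : x ∈ hV.toFinset := by simpa using hx
      rw [← Finset.add_sum_erase _ _ hx', ← Finset.add_sum_erase _ (fun v => C.degree v ^ 2) hx',
        Finset.sum_congr rfl (g := fun v => C.degree v ^ 2) fun v hv => by
          rw [C.degree_attachPendant_inl hE hk, if_neg (Finset.ne_of_mem_erase hv), add_zero],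
        C.degree_attachPendant_inl hE hk, if_pos rfl]
      ring
    rw [h1, h2]
    ring
  · rw [Set.disjoint_left]
    rintro _ ⟨e, he, rfl⟩ ⟨s, -, hs⟩
    simp at hs
  · exact hV.image _
  · exact hfin.image _

theorem isBicyclic_attachPendant {n m c : ℕ} (hk : 2 ≤ k) (hx : x ∈ C.vertexSet)
    (hC : C.IsConnected) (hu : C.IsUniform k) (hfV : C.vertexSet.Finite) (hfE : C.edgeSet.Finite)
    (hV : C.vertexSet.ncard + 1 = c * (k - 1)) (hE : C.edgeSet.ncard = c)
    (hm : c ≤ m) (hn : (n : ℤ) = m * ((k : ℤ) - 1) - 1) :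
    (C.attachPendant x k (m - c)).IsBicyclic k n m where
  uniform := IsUniform.attachPendant C hu (by omega)
  connected := IsConnected.attachPendant C hC hx
  card_vertexSet := by
    rw [C.encard_vertexSet_attachPendant hx, ← hfV.cast_ncard_eq]
    obtain ⟨s, rfl⟩ := Nat.exists_eq_add_of_le hm
    obtain ⟨K, rfl⟩ := Nat.exists_eq_add_of_le' (by omega : 1 ≤ k)
    simp only [Nat.add_sub_cancel_left, Nat.add_sub_cancel] at *
    norm_cast
    zify at *
    linarith
  card_edgeSet := by
    rw [C.encard_edgeSet_attachPendant hk, ← hfE.cast_ncard_eq, hE]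
    norm_cast
    omega
  bicyclic := hn

end Attach

/-! ### Arithmetic of the blocks of a hyperpath -/

/-- `x` lies in the `i`-th block `{i K, …, (i + 1) K}`. -/
def InBlock (K i x : ℕ) : Prop := i * K ≤ x ∧ x ≤ (i + 1) * K

namespace InBlock

variable {K i i' p x : ℕ}

theorem zero_iff (hK : 0 < K) : InBlock K i 0 ↔ i = 0 := by
  constructor
  · rintro ⟨h, -⟩
    rcases Nat.mul_eq_zero.1 (Nat.le_zero.1 h) with h | h <;> omega
  · rintro rfl
    exact ⟨by simp, by simp⟩

theorem le_mul (hi : i < p) (h : InBlock K i x) : x ≤ p * K :=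
  h.2.trans (Nat.mul_le_mul_right _ hi)

theorem mul_iff (hK : 0 < K) (hi : i < p) : InBlock K i (p * K) ↔ i + 1 = p := by
  constructor
  · rintro ⟨-, h⟩
    have := Nat.le_of_mul_le_mul_right h hK
    omega
  · rintro rfl
    exact ⟨Nat.mul_le_mul_right _ (by omega), le_rfl⟩

theorem eq_of_lt (h : i * K < x) (h' : x < (i + 1) * K) (hb : InBlock K i' x) : i' = i := by
  have h1 := lt_of_mul_lt_mul_right (hb.1.trans_lt h') (Nat.zero_le _)
  have h2 := lt_of_mul_lt_mul_right (h.trans_le hb.2) (Nat.zero_le _)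
  omega

/-- For `2 ≤ K` the point `1` is not an end of a block, so no neighbouring block contains it. The
same reason gives `pred_iff` and `mid_iff`. -/
theorem one_iff (hK : 2 ≤ K) : InBlock K i 1 ↔ i = 0 := by
  constructor
  · exact fun h => eq_of_lt (by omega) (by omega) h
  · rintro rfl
    exact ⟨by omega, by omega⟩

theorem pred_iff (hK : 2 ≤ K) (hi : i < p) : InBlock K i (p * K - 1) ↔ i + 1 = p := by
  obtain ⟨r, rfl⟩ : ∃ r, p = r + 1 := ⟨p - 1, by omega⟩
  have h1 : (r + 1) * K = r * K + K := by ring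
  constructor
  · intro h
    rw [eq_of_lt (i := r) (by omega) (by omega) h]
  · intro h
    obtain rfl : i = r := by omega
    exact ⟨by omega, by omega⟩

theorem mid_iff (hK : 2 ≤ K) : InBlock K i (i' * K + 1) ↔ i = i' := by
  have h1 : (i' + 1) * K = i' * K + K := by ring
  constructor
  · exact fun h => eq_of_lt (by omega) (by omega) h
  · rintro rfl
    exact ⟨by omega, by omega⟩

theorem self : InBlock K i (i * K) := ⟨le_rfl, Nat.mul_le_mul_right _ (by omega)⟩

theorem succ : InBlock K i ((i + 1) * K) := ⟨Nat.mul_le_mul_right _ (by omega), le_rfl⟩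

theorem eq_or (hK : 0 < K) (h : InBlock K i x) : i = x / K ∨ i = x / K - 1 := by
  have h1 : i ≤ x / K := (Nat.le_div_iff_mul_le hK).2 h.1
  have h2 : x / K ≤ i + 1 := Nat.div_le_of_le_mul (by linarith [h.2, mul_comm (i + 1) K])
  omega

theorem exists_of_le (hp : 0 < p) (hx : x ≤ p * K) : ∃ i < p, InBlock K i x := by
  rcases hx.eq_or_lt with rfl | hx
  · exact ⟨p - 1, by omega, Nat.mul_le_mul_right _ (by omega),
      by rw [Nat.sub_add_cancel hp]⟩
  · have hK : 0 < K := Nat.pos_of_mul_pos_left (by omega : 0 < p * K)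
    refine ⟨x / K, (Nat.div_lt_iff_lt_mul hK).2 hx, Nat.div_mul_le_self x K, ?_⟩
    rw [add_mul, one_mul]
    exact (Nat.lt_div_mul_add hK).le

end InBlock

/-! ### A common model of the three theta families -/

/-- The identification map of three paths: the initial vertices of the first two paths are
identified, and so are their final vertices; the initial vertex of the third path is identified
with `a`, and its final vertex with `b`. -/
def glue (k p q l : ℕ) (a b : Fin 3 × ℕ) (x : Fin 3 × ℕ) : Fin 3 × ℕ :=
  if x = (1, 0) then (0, 0)
  else if x = (1, q * (k - 1)) then (0, p * (k - 1))
  else if x = (2, 0) then a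
  else if x = (2, l * (k - 1)) then b
  else x

/-- Three paths with end vertices identified by `glue`. -/
def theta (k p q l : ℕ) (a b : Fin 3 × ℕ) : Hypergraph (Fin 3 × ℕ) :=
  (threePaths k p q l).image (glue k p q l a b)

theorem thetaOne_eq (k p q l : ℕ) : thetaOne k p q l = theta k p q l (0, 0) (0, p * (k - 1)) := by
  unfold thetaOne theta
  congr 1
  funext x
  unfold glue
  grind

theorem thetaTwo_eq (k p q l : ℕ) :
    thetaTwo k p q l = theta k p q l (0, 0) (1, q * (k - 1) - 1) := by
  unfold thetaTwo theta
  congr 1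
  funext x
  unfold glue
  grind

theorem thetaThree_eq (k p q l : ℕ) :
    thetaThree k p q l = theta k p q l (1, 1) (1, q * (k - 1) - 1) := by
  unfold thetaThree theta
  congr 1

/-- The `i`-th edge of the `j`-th path of `theta k p q l a b`. -/
def thetaEdge (k p q l : ℕ) (a b : Fin 3 × ℕ) (j : Fin 3) (i : ℕ) : Set (Fin 3 × ℕ) :=
  {v | ∃ x, InBlock (k - 1) i x ∧ glue k p q l a b (j, x) = v}

theorem mem_edgeSet_theta {k p q l : ℕ} {a b : Fin 3 × ℕ} {e : Set (Fin 3 × ℕ)} :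
    e ∈ (theta k p q l a b).edgeSet ↔
      ∃ j i, i < ![p, q, l] j ∧ e = thetaEdge k p q l a b j i := by
  have key : ∀ j i, glue k p q l a b '' (Prod.mk j '' Set.Icc (i * (k - 1)) ((i + 1) * (k - 1)))
      = thetaEdge k p q l a b j i := by
    intro j i
    ext v
    simp [thetaEdge, InBlock]
  constructor
  · rintro ⟨e', he', rfl⟩
    obtain ⟨j, _, ⟨i, hi, rfl⟩, rfl⟩ := Set.mem_iUnion.1 he'
    exact ⟨j, i, hi, key j i⟩
  · rintro ⟨j, i, hi, rfl⟩
    exact ⟨_, Set.mem_iUnion.2 ⟨j, _, ⟨i, hi, rfl⟩, rfl⟩, key j i⟩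

theorem mem_edgeSet_theta' {k p q l : ℕ} {a b : Fin 3 × ℕ} {e : Set (Fin 3 × ℕ)} :
    e ∈ (theta k p q l a b).edgeSet ↔
      (∃ i < p, e = thetaEdge k p q l a b 0 i) ∨ (∃ i < q, e = thetaEdge k p q l a b 1 i) ∨
        ∃ i < l, e = thetaEdge k p q l a b 2 i := by
  rw [mem_edgeSet_theta]
  simp [Fin.exists_fin_succ]

/-- The parameters for which `theta` is used. -/
structure IsGluing (k p q l : ℕ) (a b : Fin 3 × ℕ) : Prop where
  three_le : 3 ≤ k
  p_pos : 0 < p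
  q_pos : 0 < q
  l_pos : 0 < l
  fst_eq : a = (0, 0) ∨ a = (1, 1)
  snd_eq : b = (0, p * (k - 1)) ∨ b = (1, q * (k - 1) - 1)
  ne : a ≠ b

namespace IsGluing

variable {k p q l : ℕ} {a b : Fin 3 × ℕ}

theorem two_le (h : IsGluing k p q l a b) : 2 ≤ k - 1 := by
  have := h.three_le
  omega

theorem two_le_p (h : IsGluing k p q l a b) : 2 ≤ p * (k - 1) := by
  nlinarith [h.two_le, h.p_pos]

theorem two_le_q (h : IsGluing k p q l a b) : 2 ≤ q * (k - 1) := by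
  nlinarith [h.two_le, h.q_pos]

theorem two_le_l (h : IsGluing k p q l a b) : 2 ≤ l * (k - 1) := by
  nlinarith [h.two_le, h.l_pos]

theorem glue_zero (j : ℕ) : glue k p q l a b (0, j) = (0, j) := by
  simp [glue]

theorem mem_edge_zero {i : ℕ} {v : Fin 3 × ℕ} :
    v ∈ thetaEdge k p q l a b 0 i ↔ v.1 = 0 ∧ InBlock (k - 1) i v.2 := by
  simp only [thetaEdge, glue_zero, Set.mem_ofPred_eq]
  constructor
  · rintro ⟨x, hx, rfl⟩
    exact ⟨rfl, hx⟩
  · rintro ⟨h1, h2⟩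
    exact ⟨v.2, h2, by rw [← h1]⟩

/-- An edge consists of the points of its block that are not ends of the path, with a renamed end
added for the first and the last edge. In these coordinates incidences become arithmetic of blocks.
-/
theorem mem_edge_one (h : IsGluing k p q l a b) {i : ℕ} (hi : i < q) {v : Fin 3 × ℕ} :
    v ∈ thetaEdge k p q l a b 1 i ↔
      (v.1 = 1 ∧ InBlock (k - 1) i v.2 ∧ 0 < v.2 ∧ v.2 < q * (k - 1)) ∨ (v = (0, 0) ∧ i = 0) ∨
        (v = (0, p * (k - 1)) ∧ i + 1 = q) := by
  have hK := h.two_le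
  have hQ := h.two_le_q
  constructor
  · rintro ⟨x, hx, rfl⟩
    rcases Nat.eq_zero_or_pos x with rfl | h0
    · rw [InBlock.zero_iff (by omega)] at hx
      simp [glue, hx]
    rcases (hx.le_mul hi).eq_or_lt with rfl | h1
    · rw [InBlock.mul_iff (by omega) hi] at hx
      simp only [glue]
      grind
    · left
      simp only [glue]
      grind
  · rintro (⟨h1, h2, h3, h4⟩ | ⟨rfl, rfl⟩ | ⟨rfl, rfl⟩)
    · refine ⟨v.2, h2, ?_⟩
      simp only [glue]
      grind
    · exact ⟨0, by simp [InBlock], by simp [glue]⟩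
    · refine ⟨(i + 1) * (k - 1), InBlock.succ, ?_⟩
      simp only [glue]
      grind

theorem mem_edge_two (h : IsGluing k p q l a b) {i : ℕ} (hi : i < l) {v : Fin 3 × ℕ} :
    v ∈ thetaEdge k p q l a b 2 i ↔
      (v.1 = 2 ∧ InBlock (k - 1) i v.2 ∧ 0 < v.2 ∧ v.2 < l * (k - 1)) ∨ (v = a ∧ i = 0) ∨
        (v = b ∧ i + 1 = l) := by
  have hK := h.two_le
  have hQ := h.two_le_l
  constructor
  · rintro ⟨x, hx, rfl⟩
    rcases Nat.eq_zero_or_pos x with rfl | h0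
    · rw [InBlock.zero_iff (by omega)] at hx
      simp [glue, hx]
    rcases (hx.le_mul hi).eq_or_lt with rfl | h1
    · rw [InBlock.mul_iff (by omega) hi] at hx
      simp only [glue]
      grind
    · left
      simp only [glue]
      grind
  · rintro (⟨h1, h2, h3, h4⟩ | ⟨rfl, rfl⟩ | ⟨rfl, rfl⟩)
    · refine ⟨v.2, h2, ?_⟩
      simp only [glue]
      grind
    · exact ⟨0, by simp [InBlock], by simp [glue]⟩
    · refine ⟨(i + 1) * (k - 1), InBlock.succ, ?_⟩
      simp only [glue]
      grind

/-- Each vertex has a canonical name: the first path keeps all its points, the other two only those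
that are not ends. This makes the vertex count below `(p * (k - 1) + 1) + (q * (k - 1) - 1) + (l *
(k - 1) - 1)`. -/
theorem vertexSet (h : IsGluing k p q l a b) : (theta k p q l a b).vertexSet =
    {v | (v.1 = 0 ∧ v.2 ≤ p * (k - 1)) ∨ (v.1 = 1 ∧ 0 < v.2 ∧ v.2 < q * (k - 1)) ∨
      (v.1 = 2 ∧ 0 < v.2 ∧ v.2 < l * (k - 1))} := by
  have hP := h.two_le_p
  have hQ := h.two_le_q
  have hL := h.two_le_l
  have h1 := h.fst_eq
  have h2 := h.snd_eq
  ext v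
  constructor
  · rintro ⟨w, hw, rfl⟩
    obtain ⟨j, x, hx, rfl⟩ := Set.mem_iUnion.1 hw
    rw [Set.mem_ofPred_eq]
    fin_cases j <;> simp [hyperpath] at hx <;> simp only [glue] <;> grind
  · intro hv
    refine ⟨v, Set.mem_iUnion.2 ⟨v.1, v.2, ?_, rfl⟩, ?_⟩
    · rcases hv with hv | hv | hv <;> rw [hv.1] <;> simp [hyperpath] <;> omega
    · rw [Set.mem_ofPred_eq] at hv
      simp only [glue]
      grind

theorem finite_vertexSet (k p q l : ℕ) (a b : Fin 3 × ℕ) : (theta k p q l a b).vertexSet.Finite := by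
  refine Set.Finite.image _ (Set.finite_iUnion fun j => Set.Finite.image _ ?_)
  exact Set.finite_Iic _

theorem finite_edgeSet (k p q l : ℕ) (a b : Fin 3 × ℕ) : (theta k p q l a b).edgeSet.Finite :=
  (finite_vertexSet k p q l a b).finite_subsets.subset fun _ he => Hypergraph.subset_vertexSet_of_mem_edgeSet he

theorem ncard_vertexSet (h : IsGluing k p q l a b) :
    (theta k p q l a b).vertexSet.ncard + 1 = (p + q + l) * (k - 1) := by
  classical
  have hP := h.two_le_p
  have hQ := h.two_le_q
  have hL := h.two_le_l
  have : (theta k p q l a b).vertexSet =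
      ((({0} : Finset (Fin 3)) ×ˢ Finset.range (p * (k - 1) + 1) ∪
        ({1} : Finset (Fin 3)) ×ˢ Finset.Ioo 0 (q * (k - 1))) ∪
        ({2} : Finset (Fin 3)) ×ˢ Finset.Ioo 0 (l * (k - 1)) : Finset (Fin 3 × ℕ)) := by
    rw [h.vertexSet]
    ext v
    simp
    grind
  rw [this, Set.ncard_coe_finset, Finset.card_union_of_disjoint, Finset.card_union_of_disjoint]
  · simp
    rw [add_mul, add_mul]
    omega
  · rw [Finset.disjoint_left]
    intro v
    simp
    grind
  · rw [Finset.disjoint_left]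
    intro v
    simp
    grind

/-- The second point of a block is not an end of its path, since `k - 1 ≥ 2`. It keeps its name and
serves as a marker of its edge. -/
theorem mid_mem (h : IsGluing k p q l a b) {j : Fin 3} {i : ℕ} (hi : i < ![p, q, l] j) :
    (j, i * (k - 1) + 1) ∈ thetaEdge k p q l a b j i := by
  have hK := h.two_le
  have h1 : (i + 1) * (k - 1) ≤ ![p, q, l] j * (k - 1) := Nat.mul_le_mul_right _ hi
  have h2 : (i + 1) * (k - 1) = i * (k - 1) + (k - 1) := by ring
  have h3 := (InBlock.mid_iff hK (i := i) (i' := i)).2 rfl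
  fin_cases j
  · exact mem_edge_zero.2 ⟨rfl, h3⟩
  · exact (h.mem_edge_one hi).2 (Or.inl ⟨rfl, h3, Nat.succ_pos _, by simp at h1 ⊢; omega⟩)
  · exact (h.mem_edge_two hi).2 (Or.inl ⟨rfl, h3, Nat.succ_pos _, by simp at h1 ⊢; omega⟩)

/-- The order `j ≤ j'` matters: a marker on the second path may be `a` or `b`, and then it also lies
on the third path. A marker of a later path never lies on an earlier one. -/
theorem eq_of_mid_mem (h : IsGluing k p q l a b) {j j' : Fin 3} {i i' : ℕ} (hj : j ≤ j')
    (hi : i < ![p, q, l] j) (hi' : i' < ![p, q, l] j')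
    (hmem : (j', i' * (k - 1) + 1) ∈ thetaEdge k p q l a b j i) : j = j' ∧ i = i' := by
  have hK := h.two_le
  have h1 := h.fst_eq
  have h2 := h.snd_eq
  have h3 := InBlock.mid_iff hK (i := i) (i' := i')
  fin_cases j
  · rw [Fin.mk_zero, mem_edge_zero] at hmem
    exact ⟨hmem.1.symm, h3.1 hmem.2⟩
  · rw [Fin.mk_one, h.mem_edge_one hi] at hmem
    fin_cases j'
    all_goals simp at hj hmem ⊢
    all_goals grind
  · have : thetaEdge k p q l a b ⟨2, by decide⟩ i = thetaEdge k p q l a b 2 i := rfl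
    rw [this, h.mem_edge_two hi] at hmem
    fin_cases j'
    all_goals simp at hj hmem ⊢
    all_goals grind

theorem thetaEdge_inj (h : IsGluing k p q l a b) {j j' : Fin 3} {i i' : ℕ}
    (hi : i < ![p, q, l] j) (hi' : i' < ![p, q, l] j')
    (heq : thetaEdge k p q l a b j i = thetaEdge k p q l a b j' i') : j = j' ∧ i = i' := by
  rcases le_total j j' with hj | hj
  · exact h.eq_of_mid_mem hj hi hi' (heq ▸ h.mid_mem hi')
  · have := h.eq_of_mid_mem hj hi' hi (heq ▸ h.mid_mem hi)
    exact ⟨this.1.symm, this.2.symm⟩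

theorem ncard_edgeSet (h : IsGluing k p q l a b) :
    (theta k p q l a b).edgeSet.ncard = p + q + l := by
  classical
  have : (theta k p q l a b).edgeSet = (fun y : Fin 3 × ℕ => thetaEdge k p q l a b y.1 y.2) ''
      ((Finset.univ : Finset (Fin 3)).biUnion
        fun j => {j} ×ˢ Finset.range (![p, q, l] j) : Finset (Fin 3 × ℕ)) := by
    ext e
    rw [mem_edgeSet_theta]
    constructor
    · rintro ⟨j, i, hi, rfl⟩
      exact ⟨(j, i), by simpa using hi, rfl⟩
    · rintro ⟨⟨j, i⟩, hi, rfl⟩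
      exact ⟨j, i, by simpa using hi, rfl⟩
  rw [this, Set.InjOn.ncard_image, Set.ncard_coe_finset, Finset.card_biUnion]
  · simp [Fin.sum_univ_three]
  · intro j _ j' _ hne
    rw [Function.onFun, Finset.disjoint_left]
    intro v
    simp
    grind
  · rintro ⟨j, i⟩ hi ⟨j', i'⟩ hi' heq
    have := h.thetaEdge_inj (j := j) (j' := j') (by simpa using hi) (by simpa using hi') heq
    exact Prod.ext this.1 this.2

/-- Only the two ends of a path are moved, and they go to distinct points off the path; for the
third path this is `a ≠ b`. -/
theorem injOn_glue (h : IsGluing k p q l a b) (j : Fin 3) :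
    (Set.Iic (![p, q, l] j * (k - 1))).InjOn fun x => glue k p q l a b (j, x) := by
  have hP := h.two_le_p
  have hQ := h.two_le_q
  have hL := h.two_le_l
  have h1 := h.fst_eq
  have h2 := h.snd_eq
  have h3 := h.ne
  intro x hx y hy hxy
  fin_cases j <;> simp [glue] at hx hy hxy <;> grind

theorem isUniform (h : IsGluing k p q l a b) : (theta k p q l a b).IsUniform k := by
  have hK := h.two_le
  intro e he
  obtain ⟨j, i, hi, rfl⟩ := mem_edgeSet_theta.1 he
  have : thetaEdge k p q l a b j i =
      (fun x => glue k p q l a b (j, x)) '' (Finset.Icc (i * (k - 1)) ((i + 1) * (k - 1)) :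
        Finset ℕ) := by
    ext v
    simp [thetaEdge, InBlock]
  rw [this, ((h.injOn_glue j).mono _).encard_image, Set.encard_coe_eq_coe_finsetCard, Nat.card_Icc]
  · have h2 : (i + 1) * (k - 1) = i * (k - 1) + (k - 1) := by ring
    norm_cast
    omega
  · intro x hx
    exact InBlock.le_mul hi (by simpa [InBlock] using hx)

theorem exists_edge (h : IsGluing k p q l a b) {v : Fin 3 × ℕ}
    (hv : v ∈ (theta k p q l a b).vertexSet) : ∃ e ∈ (theta k p q l a b).edgeSet, v ∈ e := by
  rw [h.vertexSet] at hv
  rcases hv with ⟨h1, h2⟩ | ⟨h1, h2, h3⟩ | ⟨h1, h2, h3⟩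
  · obtain ⟨i, hi, hb⟩ := InBlock.exists_of_le h.p_pos h2
    exact ⟨_, mem_edgeSet_theta'.2 (Or.inl ⟨i, hi, rfl⟩), mem_edge_zero.2 ⟨h1, hb⟩⟩
  · obtain ⟨i, hi, hb⟩ := InBlock.exists_of_le h.q_pos h3.le
    exact ⟨_, mem_edgeSet_theta'.2 (Or.inr (Or.inl ⟨i, hi, rfl⟩)),
      (h.mem_edge_one hi).2 (Or.inl ⟨h1, hb, h2, h3⟩)⟩
  · obtain ⟨i, hi, hb⟩ := InBlock.exists_of_le h.l_pos h3.le
    exact ⟨_, mem_edgeSet_theta'.2 (Or.inr (Or.inr ⟨i, hi, rfl⟩)),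
      (h.mem_edge_two hi).2 (Or.inl ⟨h1, hb, h2, h3⟩)⟩

theorem degree_le_two_of_subset {α : Type*} {H : Hypergraph α} {v : α} (e e' : Set α)
    (hs : ∀ e'' ∈ H.edgeSet, v ∈ e'' → e'' = e ∨ e'' = e') : H.degree v ≤ 2 := by
  refine (Set.ncard_le_ncard (t := {e, e'}) ?_ (Set.toFinite _)).trans
    ((Set.ncard_insert_le e {e'}).trans (by rw [Set.ncard_singleton]))
  rintro e'' ⟨h1, h2⟩
  exact hs e'' h1 h2

/-- In each case two edges are named that exhaust those through `v`. The hypotheses exclude a common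
end of the first two paths at which the third path is attached as well. -/
theorem degree_le_two (h : IsGluing k p q l a b) {v : Fin 3 × ℕ}
    (h0 : v = (0, 0) → v ≠ a) (h1 : v = (0, p * (k - 1)) → v ≠ b) :
    (theta k p q l a b).degree v ≤ 2 := by
  have hK := h.two_le
  have ha := h.fst_eq
  have hb := h.snd_eq
  have hne := h.ne
  have hP := h.two_le_p
  have hQ := h.two_le_q
  obtain ⟨j, x⟩ := v
  by_cases hva : (j, x) = a
  · have h3 : a = (1, 1) := by grind
    refine degree_le_two_of_subset (thetaEdge k p q l a b 1 0) (thetaEdge k p q l a b 2 0) ?_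
    intro e he hv
    rw [hva, h3] at hv
    rcases mem_edgeSet_theta'.1 he with ⟨i, hi, rfl⟩ | ⟨i, hi, rfl⟩ | ⟨i, hi, rfl⟩
    · rw [mem_edge_zero] at hv
      simp at hv
    · rw [h.mem_edge_one hi, InBlock.one_iff hK] at hv
      grind
    · rw [h.mem_edge_two hi] at hv
      grind
  by_cases hvb : (j, x) = b
  · have h3 : b = (1, q * (k - 1) - 1) := by grind
    refine degree_le_two_of_subset (thetaEdge k p q l a b 1 (q - 1))
      (thetaEdge k p q l a b 2 (l - 1)) ?_
    intro e he hv
    rw [hvb, h3] at hv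
    rcases mem_edgeSet_theta'.1 he with ⟨i, hi, rfl⟩ | ⟨i, hi, rfl⟩ | ⟨i, hi, rfl⟩
    · rw [mem_edge_zero] at hv
      simp at hv
    · rw [h.mem_edge_one hi, InBlock.pred_iff hK hi] at hv
      grind
    · rw [h.mem_edge_two hi] at hv
      grind
  by_cases hv0 : (j, x) = (0, 0)
  · refine degree_le_two_of_subset (thetaEdge k p q l a b 0 0) (thetaEdge k p q l a b 1 0) ?_
    intro e he hv
    rcases mem_edgeSet_theta'.1 he with ⟨i, hi, rfl⟩ | ⟨i, hi, rfl⟩ | ⟨i, hi, rfl⟩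
    · rw [hv0, mem_edge_zero, InBlock.zero_iff (by omega)] at hv
      grind
    · rw [h.mem_edge_one hi] at hv
      grind
    · rw [h.mem_edge_two hi] at hv
      grind
  by_cases hvP : (j, x) = (0, p * (k - 1))
  · refine degree_le_two_of_subset (thetaEdge k p q l a b 0 (p - 1))
      (thetaEdge k p q l a b 1 (q - 1)) ?_
    intro e he hv
    rcases mem_edgeSet_theta'.1 he with ⟨i, hi, rfl⟩ | ⟨i, hi, rfl⟩ | ⟨i, hi, rfl⟩
    · rw [hvP, mem_edge_zero, InBlock.mul_iff (by omega) hi] at hv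
      grind
    · rw [h.mem_edge_one hi] at hv
      grind
    · rw [h.mem_edge_two hi] at hv
      grind
  -- Here `v` is touched by no identification, so it lies only on its own path, in the block of
  -- index `x / (k - 1)` and possibly the previous one.
  · refine degree_le_two_of_subset (thetaEdge k p q l a b j (x / (k - 1)))
      (thetaEdge k p q l a b j (x / (k - 1) - 1)) ?_
    intro e he hv
    rcases mem_edgeSet_theta'.1 he with ⟨i, hi, rfl⟩ | ⟨i, hi, rfl⟩ | ⟨i, hi, rfl⟩
    · rw [mem_edge_zero] at hv
      have := hv.2.eq_or (by omega)
      grind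
    · rw [h.mem_edge_one hi] at hv
      have : InBlock (k - 1) i x := by grind
      have := this.eq_or (by omega)
      grind
    · rw [h.mem_edge_two hi] at hv
      have : InBlock (k - 1) i x := by grind
      have := this.eq_or (by omega)
      grind

theorem degree_eq_three (h : IsGluing k p q l a b) {v : Fin 3 × ℕ} {i₀ i₁ i₂ : ℕ}
    (hi₀ : i₀ < p) (hi₁ : i₁ < q) (hi₂ : i₂ < l)
    (h₀ : ∀ i < p, v ∈ thetaEdge k p q l a b 0 i ↔ i = i₀)
    (h₁ : ∀ i < q, v ∈ thetaEdge k p q l a b 1 i ↔ i = i₁)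
    (h₂ : ∀ i < l, v ∈ thetaEdge k p q l a b 2 i ↔ i = i₂) :
    (theta k p q l a b).degree v = 3 := by
  rw [degree, Set.ncard_eq_three]
  refine ⟨thetaEdge k p q l a b 0 i₀, thetaEdge k p q l a b 1 i₁, thetaEdge k p q l a b 2 i₂,
    fun hc => ?_, fun hc => ?_, fun hc => ?_, ?_⟩
  · exact absurd (h.thetaEdge_inj (j := 0) (j' := 1) hi₀ hi₁ hc).1 (by decide)
  · exact absurd (h.thetaEdge_inj (j := 0) (j' := 2) hi₀ hi₂ hc).1 (by decide)
  · exact absurd (h.thetaEdge_inj (j := 1) (j' := 2) hi₁ hi₂ hc).1 (by decide)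
  · ext e
    simp only [Set.mem_ofPred_eq, Set.mem_insert_iff, Set.mem_singleton_iff, mem_edgeSet_theta']
    grind

theorem degree_first (h : IsGluing k p q l a b) (ha : a = (0, 0)) :
    (theta k p q l a b).degree (0, 0) = 3 := by
  have hK := h.two_le
  have hP := h.two_le_p
  have hne := h.ne
  have hb := h.snd_eq
  refine h.degree_eq_three h.p_pos h.q_pos h.l_pos (fun i hi => ?_) (fun i hi => ?_)
    (fun i hi => ?_)
  · rw [mem_edge_zero, InBlock.zero_iff (by omega)]
    simp
  · rw [h.mem_edge_one hi]
    grind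
  · rw [h.mem_edge_two hi]
    grind

theorem degree_last (h : IsGluing k p q l a b) (hb : b = (0, p * (k - 1))) :
    (theta k p q l a b).degree (0, p * (k - 1)) = 3 := by
  have hK := h.two_le
  have hP := h.two_le_p
  have hne := h.ne
  have ha := h.fst_eq
  have h1 := h.p_pos
  have h2 := h.q_pos
  have h3 := h.l_pos
  refine h.degree_eq_three (i₀ := p - 1) (i₁ := q - 1) (i₂ := l - 1) (by omega) (by omega)
    (by omega) (fun i hi => ?_) (fun i hi => ?_) (fun i hi => ?_)
  · rw [mem_edge_zero, InBlock.mul_iff (by omega) hi]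
    grind
  · rw [h.mem_edge_one hi]
    grind
  · rw [h.mem_edge_two hi]
    grind

/-- Degrees `d` in `{1, 2, 3}` satisfy `d ^ 2 + 2 = 3 * d`, plus `2` if `d = 3`. Summing reduces the
Zagreb index to the degree sum, the number of vertices and the number of vertices of degree `3`. -/
theorem zagreb (h : IsGluing k p q l a b) (T : Finset (Fin 3 × ℕ))
    (hT : ∀ v ∈ T, v ∈ (theta k p q l a b).vertexSet ∧ (theta k p q l a b).degree v = 3)
    (hT' : ∀ v ∉ T, (theta k p q l a b).degree v ≤ 2) :
    (theta k p q l a b).zagreb = (p + q + l) * (k + 2) + 2 + 2 * T.card := by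
  classical
  set V := (finite_vertexSet k p q l a b).toFinset with hV
  have hTV : T ⊆ V := fun v hv => by simpa [hV] using (hT v hv).1
  have h1 : ∀ v ∈ V, (theta k p q l a b).degree v ^ 2 + 2 =
      3 * (theta k p q l a b).degree v + if v ∈ T then 2 else 0 := by
    intro v hv
    have h2 : 1 ≤ (theta k p q l a b).degree v :=
      (one_le_degree_iff (finite_edgeSet k p q l a b) v).2 (h.exists_edge (by simpa [hV] using hv))
    split_ifs with hvT
    · rw [(hT v hvT).2]; rfl
    · have := hT' v hvT
      interval_cases (theta k p q l a b).degree v <;> rfl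
  have h3 := Finset.sum_congr rfl h1
  rw [Finset.sum_add_distrib, Finset.sum_add_distrib, ← Finset.mul_sum,
    sum_degree _ (finite_vertexSet k p q l a b) (finite_edgeSet k p q l a b) h.isUniform, h.ncard_edgeSet,
    ← zagreb_eq_sum, Finset.sum_const, ← Finset.sum_filter, Finset.filter_mem_eq_inter,
    Finset.inter_eq_right.2 hTV, Finset.sum_const, hV, ← Set.ncard_eq_toFinset_card _ (finite_vertexSet k p q l a b)] at h3
  have h4 := h.ncard_vertexSet
  obtain ⟨K, rfl⟩ := Nat.exists_eq_add_of_le' (by have := h.three_le; omega : 1 ≤ k)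
  simp only [Nat.add_sub_cancel, smul_eq_mul] at h3 h4
  nlinarith

theorem first_mem (h : IsGluing k p q l a b) : (0, 0) ∈ (theta k p q l a b).vertexSet := by
  rw [h.vertexSet]
  simp

theorem last_mem (h : IsGluing k p q l a b) :
    (0, p * (k - 1)) ∈ (theta k p q l a b).vertexSet := by
  rw [h.vertexSet]
  simp

/-- The hypercycle runs along the first path and back along the second, through their joints. After
`p` steps, position `i` is joint `p + q - i` of the second path, and the edge leaving it has index
`p + q - 1 - i`. -/
theorem hasHypercycle (h : IsGluing k p q l a b) :
    (theta k p q l a b).HasHypercycle (p + q) := by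
  have hp := h.p_pos
  have hq := h.q_pos
  have hK : 0 < k - 1 := by have := h.two_le; omega
  refine ⟨by omega, fun i => if i ≤ p then (0, i * (k - 1)) else (1, (p + q - i) * (k - 1)),
    fun i => if i < p then thetaEdge k p q l a b 0 i else thetaEdge k p q l a b 1 (p + q - 1 - i),
    ?_, ?_, ?_⟩
  · intro i hi j hj hij
    simp only [Set.mem_Iio] at hi hj
    simp only at hij
    split_ifs at hij with h1 h2 h2
    · exact Nat.eq_of_mul_eq_mul_right hK (Prod.ext_iff.1 hij).2
    · exact absurd (congrArg Prod.fst hij) (by simp)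
    · exact absurd (congrArg Prod.fst hij) (by simp)
    · have := Nat.eq_of_mul_eq_mul_right hK (Prod.ext_iff.1 hij).2
      omega
  · intro i hi j hj hij
    simp only [Set.mem_Iio] at hi hj
    simp only at hij
    split_ifs at hij with h1 h2 h2
    · exact (h.thetaEdge_inj (j := 0) (j' := 0) h1 h2 hij).2
    · exact absurd (h.thetaEdge_inj (j := 0) (j' := 1) h1
        (show p + q - 1 - j < q by omega) hij).1 (by decide)
    · exact absurd (h.thetaEdge_inj (j := 1) (j' := 0) (show p + q - 1 - i < q by omega)
        h2 hij).1 (by decide)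
    · have := (h.thetaEdge_inj (j := 1) (j' := 1) (show p + q - 1 - i < q by omega)
        (show p + q - 1 - j < q by omega) hij).2
      omega
  · intro i hi
    by_cases h1 : i < p
    · simp only [h1, if_true, h1.le, Nat.mod_eq_of_lt (show i + 1 < p + q by omega),
        show i + 1 ≤ p by omega]
      exact ⟨mem_edgeSet_theta'.2 (Or.inl ⟨i, h1, rfl⟩), mem_edge_zero.2 ⟨rfl, InBlock.self⟩,
        mem_edge_zero.2 ⟨rfl, InBlock.succ⟩⟩
    · simp only [h1, if_false]
      have h2 : p + q - 1 - i < q := by omega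
      refine ⟨mem_edgeSet_theta'.2 (Or.inr (Or.inl ⟨_, h2, rfl⟩)), ?_, ?_⟩
      · rw [h.mem_edge_one h2]
        split_ifs with h3
        · obtain rfl : i = p := by omega
          exact Or.inr (Or.inr ⟨rfl, by omega⟩)
        · left
          have h4 : p + q - i = p + q - 1 - i + 1 := by omega
          refine ⟨rfl, by rw [h4]; exact InBlock.succ, Nat.mul_pos (by omega) hK,
            Nat.mul_lt_mul_of_pos_right (by omega) hK⟩
      · rw [h.mem_edge_one h2]
        rcases (show i + 1 ≤ p + q from hi).eq_or_lt with h3 | h3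
        · rw [h3, Nat.mod_self, if_pos (Nat.zero_le _)]
          exact Or.inr (Or.inl ⟨by simp, by omega⟩)
        · rw [Nat.mod_eq_of_lt h3, if_neg (by omega)]
          left
          have h4 : p + q - (i + 1) = p + q - 1 - i := by omega
          refine ⟨rfl, by rw [h4]; exact InBlock.self, Nat.mul_pos (by omega) hK,
            Nat.mul_lt_mul_of_pos_right (by omega) hK⟩

theorem glue_mem_edge {j : Fin 3} {i x : ℕ} (hx : InBlock (k - 1) i x) :
    glue k p q l a b (j, x) ∈ thetaEdge k p q l a b j i := ⟨x, hx, rfl⟩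

/-- With `a = (0, 0)` all three paths start at the same vertex, and every vertex can be walked back
to it from joint to joint. -/
theorem isConnected (h : IsGluing k p q l a b) (ha : a = (0, 0)) :
    (theta k p q l a b).IsConnected := by
  refine isConnected_of_forall_reaches h.first_mem ?_
  have h0 : ∀ j, glue k p q l a b (j, 0) = (0, 0) := by
    intro j
    fin_cases j <;> simp [glue, ha]
  have hstep : ∀ j i x, i < ![p, q, l] j → InBlock (k - 1) i x →
      (theta k p q l a b).Adj (glue k p q l a b (j, x)) (glue k p q l a b (j, i * (k - 1))) :=
    fun j i x hi hx => ⟨_, mem_edgeSet_theta.2 ⟨j, i, hi, rfl⟩, glue_mem_edge hx,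
      glue_mem_edge InBlock.self⟩
  have hjoint : ∀ j i, i < ![p, q, l] j → Relation.ReflTransGen (theta k p q l a b).Adj
      (glue k p q l a b (j, i * (k - 1))) (0, 0) := by
    intro j i
    induction i with
    | zero => intro _; rw [zero_mul, h0]
    | succ i ih =>
      intro hi
      exact .head (hstep j i _ (by omega) InBlock.succ) (ih (by omega))
  rintro w ⟨y, hy, rfl⟩
  obtain ⟨j, x, hx, rfl⟩ := Set.mem_iUnion.1 hy
  have hpos : 0 < ![p, q, l] j := by
    have h1 := h.p_pos
    have h2 := h.q_pos
    have h3 := h.l_pos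
    fin_cases j <;> simpa
  obtain ⟨i, hi, hb⟩ := InBlock.exists_of_le hpos hx
  exact .head (hstep j i x hi hb) (hjoint j i hi)

end IsGluing

/-! ### Linked edge sets -/

/-- Every member of `S` has two distinct vertices that lie in other members of `S`. -/
def IsLinked {α : Type*} (S : Set (Set α)) : Prop :=
  ∀ e ∈ S, ∃ u ∈ e, ∃ v ∈ e, u ≠ v ∧ (∃ e' ∈ S, e' ≠ e ∧ u ∈ e') ∧ ∃ e' ∈ S, e' ≠ e ∧ v ∈ e'

/-- Linkedness asks for two distinct contact vertices, so an edge with only two candidates must use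
both. -/
theorem IsLinked.exists_of_forall {α : Type*} {S : Set (Set α)} (hS : IsLinked S) {e : Set α}
    (he : e ∈ S) {w₁ w₂ : α}
    (h : ∀ w ∈ e, ∀ e' ∈ S, e' ≠ e → w ∈ e' → w = w₁ ∨ w = w₂) :
    (∃ e' ∈ S, e' ≠ e ∧ w₁ ∈ e') ∧ ∃ e' ∈ S, e' ≠ e ∧ w₂ ∈ e' := by
  obtain ⟨u, hu, v, hv, huv, ⟨e₁, h₁, hne₁, hu₁⟩, e₂, h₂, hne₂, hv₂⟩ := hS e he
  rcases h u hu e₁ h₁ hne₁ hu₁ with rfl | rfl <;> rcases h v hv e₂ h₂ hne₂ hv₂ with rfl | rfl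
  · exact absurd rfl huv
  · exact ⟨⟨e₁, h₁, hne₁, hu₁⟩, e₂, h₂, hne₂, hv₂⟩
  · exact ⟨⟨e₂, h₂, hne₂, hv₂⟩, e₁, h₁, hne₁, hu₁⟩
  · exact absurd rfl huv

/-- Each edge of a hypercycle meets its predecessor and its successor in distinct vertices. The
cyclic order is dropped; linkedness is enough to bound the length from below. -/
theorem HasHypercycle.exists_isLinked {α : Type*} {H : Hypergraph α} {L : ℕ}
    (h : H.HasHypercycle L) :
    ∃ S ⊆ H.edgeSet, S.Finite ∧ S.ncard = L ∧ IsLinked S := by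
  obtain ⟨hL, x, e, hx, he, h⟩ := h
  refine ⟨e '' Set.Iio L, ?_, (Set.finite_Iio L).image e, ?_, ?_⟩
  · rintro _ ⟨i, hi, rfl⟩
    exact (h i hi).1
  · rw [he.ncard_image, Set.ncard, encard_Iio]
    rfl
  · rintro _ ⟨i, hi, rfl⟩
    rw [Set.mem_Iio] at hi
    have hnext : (i + 1) % L < L := Nat.mod_lt _ (by omega)
    have hne : (i + 1) % L ≠ i := by
      rcases (show i + 1 ≤ L from hi).eq_or_lt with h1 | h1
      · rw [h1, Nat.mod_self]; omega
      · rw [Nat.mod_eq_of_lt h1]; omega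
    refine ⟨x i, (h i hi).2.1, x ((i + 1) % L), (h i hi).2.2, fun hc => hne (hx hnext hi hc.symm),
      ?_, e ((i + 1) % L), ⟨_, hnext, rfl⟩, fun hc => hne (he hnext hi hc), (h _ hnext).2.1⟩
    -- `j` is the cyclic predecessor of `i`.
    obtain ⟨j, hj, hji, hjne⟩ : ∃ j < L, (j + 1) % L = i ∧ j ≠ i := by
      rcases Nat.eq_zero_or_pos i with rfl | h0
      · exact ⟨L - 1, by omega, by rw [Nat.sub_add_cancel (by omega), Nat.mod_self], by omega⟩
      · exact ⟨i - 1, by omega, by rw [Nat.sub_add_cancel h0, Nat.mod_eq_of_lt hi], by omega⟩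
    exact ⟨e j, ⟨j, hj, rfl⟩, fun hc => hjne (he hj hi hc), hji ▸ (h j hj).2.2⟩

/-- A pendant edge meets other edges only in `x`, so it cannot belong to a linked set, and the whole
set comes from `C`. -/
theorem exists_isLinked_of_attachPendant {β : Type*} {C : Hypergraph β} {x : β} {k t L : ℕ}
    (h : (C.attachPendant x k t).HasHypercycle L) :
    ∃ S ⊆ C.edgeSet, S.Finite ∧ S.ncard = L ∧ IsLinked S := by
  obtain ⟨S, hSE, hfin, hL, hS⟩ := h.exists_isLinked
  have hpend : ∀ s, pendantEdge x k s ∉ S := by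
    intro s hs
    have hx : ∀ w ∈ pendantEdge x k s, ∀ e' ∈ S, e' ≠ pendantEdge x k s → w ∈ e' →
        w = Sum.inl x := by
      rintro (b | y) hw e' he' hne hwe'
      · rw [mem_pendantEdge_inl.1 hw]
      · rcases (mem_edgeSet_attachPendant C).1 (hSE he') with ⟨e'', -, rfl⟩ | ⟨s', -, rfl⟩
        · simp at hwe'
        · rw [mem_pendantEdge_inr] at hw hwe'
          exact absurd (by rw [← hw.1, ← hwe'.1]) hne
    obtain ⟨u, hu, v, hv, huv, ⟨e₁, h₁, hne₁, hu₁⟩, e₂, h₂, hne₂, hv₂⟩ := hS _ hs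
    exact huv ((hx u hu e₁ h₁ hne₁ hu₁).trans (hx v hv e₂ h₂ hne₂ hv₂).symm)
  have hinj : Function.Injective (Set.image (Sum.inl : β → β ⊕ ℕ × ℕ)) :=
    Sum.inl_injective.image_injective
  have hall : ∀ e ∈ S, ∃ e' ∈ C.edgeSet, Sum.inl '' e' = e := by
    intro e he
    rcases (mem_edgeSet_attachPendant C).1 (hSE he) with h | ⟨s, -, rfl⟩
    · exact h
    · exact absurd he (hpend s)
  have himage : Set.image Sum.inl '' (Set.image Sum.inl ⁻¹' S) = S :=
    Set.image_preimage_eq_of_subset fun e he => by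
      obtain ⟨e', -, rfl⟩ := hall e he
      exact ⟨e', rfl⟩
  refine ⟨Set.image Sum.inl ⁻¹' S, fun e he => ?_, hfin.preimage hinj.injOn, ?_, fun e he => ?_⟩
  · obtain ⟨e', he', heq⟩ := hall _ he
    rwa [← hinj heq]
  · rw [← hL, ← Set.ncard_image_of_injective _ hinj, himage]
  · obtain ⟨_, ⟨u, hu, rfl⟩, _, ⟨v, hv, rfl⟩, huv, ⟨e₁, h₁, hne₁, hu₁⟩, e₂, h₂, hne₂, hv₂⟩ :=
      hS _ he
    obtain ⟨e₁, -, rfl⟩ := hall e₁ h₁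
    obtain ⟨e₂, -, rfl⟩ := hall e₂ h₂
    exact ⟨u, hu, v, hv, fun hc => huv (by rw [hc]),
      ⟨e₁, h₁, fun hc => hne₁ (by rw [hc]), by simpa using hu₁⟩,
      e₂, h₂, fun hc => hne₂ (by rw [hc]), by simpa using hv₂⟩

theorem forall_arm_mem {β : Type*} {S : Set β} {h : ℕ} {arm : ℕ → β}
    (up : ∀ i, i + 1 < h → arm i ∈ S → arm (i + 1) ∈ S)
    (down : ∀ i, i + 1 < h → arm (i + 1) ∈ S → arm i ∈ S)
    {i : ℕ} (hi : i < h) (hmem : arm i ∈ S) : ∀ i' < h, arm i' ∈ S := by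
  have h0 : arm 0 ∈ S := by
    induction i with
    | zero => exact hmem
    | succ i ih => exact ih (by omega) (down i hi hmem)
  intro i' hi'
  induction i' with
  | zero => exact h0
  | succ i' ih => exact up i' hi' (ih (by omega))

/-- Membership spreads along an arm in both directions, and from its start to the start of another
arm; so `S` contains two disjoint arms of `h` edges. -/
theorem two_mul_le_ncard {β : Type*} {S : Set β} (hfin : S.Finite) {h : ℕ} {arm : Fin 3 → ℕ → β}
    (hinj : ∀ j i j' i', i < h → i' < h → arm j i = arm j' i' → j = j' ∧ i = i')
    (up : ∀ j i, i + 1 < h → arm j i ∈ S → arm j (i + 1) ∈ S)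
    (down : ∀ j i, i + 1 < h → arm j (i + 1) ∈ S → arm j i ∈ S)
    (start : ∀ j, 0 < h → arm j 0 ∈ S → ∃ j' ≠ j, arm j' 0 ∈ S)
    (hex : ∃ j, ∃ i < h, arm j i ∈ S) : 2 * h ≤ S.ncard := by
  classical
  obtain ⟨j, i, hi, hmem⟩ := hex
  have h1 := forall_arm_mem (up j) (down j) hi hmem
  have hpos : 0 < h := by omega
  obtain ⟨j', hne, hmem'⟩ := start j hpos (h1 0 hpos)
  have h2 := forall_arm_mem (up j') (down j') hpos hmem'
  have h3 : (((({j, j'} : Finset (Fin 3)) ×ˢ Finset.range h).image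
      fun y : Fin 3 × ℕ => arm y.1 y.2 : Finset β) : Set β) ⊆ S := by
    intro e he
    simp only [Finset.coe_image, Set.mem_image, Finset.mem_coe, Finset.mem_product,
      Finset.mem_insert, Finset.mem_singleton, Finset.mem_range] at he
    obtain ⟨⟨u, v⟩, ⟨rfl | rfl, hv⟩, rfl⟩ := he
    · exact h1 _ hv
    · exact h2 _ hv
  have h4 := Set.ncard_le_ncard h3 hfin
  rw [Set.ncard_coe_finset, Finset.card_image_of_injOn, Finset.card_product,
    Finset.card_pair hne.symm, Finset.card_range] at h4
  · exact h4
  · rintro ⟨u, v⟩ hu ⟨u', v'⟩ hu' heq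
    have := hinj u v u' v' (by simpa using (Finset.mem_product.1 hu).2)
      (by simpa using (Finset.mem_product.1 hu').2) heq
    exact Prod.ext this.1 this.2

namespace IsGluing

variable {k p q l : ℕ} {a b : Fin 3 × ℕ}

theorem glue_first (ha : a = (0, 0)) (j : Fin 3) : glue k p q l a b (j, 0) = (0, 0) := by
  fin_cases j <;> simp [glue, ha]

theorem glue_of_lt {j : Fin 3} {x : ℕ} (h0 : 0 < x) (h1 : x < ![p, q, l] j * (k - 1)) :
    glue k p q l a b (j, x) = (j, x) := by
  fin_cases j
  all_goals simp at h1
  all_goals simp only [glue]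
  all_goals grind

theorem glue_last_two (h : IsGluing k p q l a b) :
    glue k p q l a b (2, l * (k - 1)) = b := by
  have := h.two_le_l
  simp only [glue]
  grind

/-- A joint of a path lies in the two adjacent edges of this path only. -/
theorem eq_or_of_joint_mem (h : IsGluing k p q l a b) {j : Fin 3} {r : ℕ} (h0 : 0 < r)
    (hr : r < ![p, q, l] j) {e : Set (Fin 3 × ℕ)} (he : e ∈ (theta k p q l a b).edgeSet)
    (hmem : (j, r * (k - 1)) ∈ e) :
    e = thetaEdge k p q l a b j r ∨ e = thetaEdge k p q l a b j (r - 1) := by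
  have hK := h.two_le
  have ha := h.fst_eq
  have hb := h.snd_eq
  have h1 : (r + 1) * (k - 1) ≤ ![p, q, l] j * (k - 1) := Nat.mul_le_mul_right _ hr
  have h2 : (r + 1) * (k - 1) = r * (k - 1) + (k - 1) := by ring
  have h3 : 1 * (k - 1) ≤ r * (k - 1) := Nat.mul_le_mul_right _ h0
  have h4 : r * (k - 1) / (k - 1) = r := Nat.mul_div_cancel _ (by omega)
  have h5 : ∀ i, InBlock (k - 1) i (r * (k - 1)) → i = r ∨ i = r - 1 := by
    intro i hi
    have := hi.eq_or (by omega)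
    rwa [h4] at this
  rcases mem_edgeSet_theta'.1 he with ⟨i, hi, rfl⟩ | ⟨i, hi, rfl⟩ | ⟨i, hi, rfl⟩
  · rw [mem_edge_zero] at hmem
    have := h5 i hmem.2
    have := hmem.1
    grind
  · rw [h.mem_edge_one hi] at hmem
    fin_cases j
    all_goals simp at hmem h1 ⊢
    all_goals grind
  · rw [h.mem_edge_two hi] at hmem
    fin_cases j
    all_goals simp at hmem h1 ⊢
    all_goals grind

theorem eq_of_first_mem (h : IsGluing k p q l a b)
    {e : Set (Fin 3 × ℕ)} (he : e ∈ (theta k p q l a b).edgeSet) (hmem : (0, 0) ∈ e) :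
    ∃ j, e = thetaEdge k p q l a b j 0 := by
  have hK := h.two_le
  have hP := h.two_le_p
  have hb := h.snd_eq
  rcases mem_edgeSet_theta'.1 he with ⟨i, hi, rfl⟩ | ⟨i, hi, rfl⟩ | ⟨i, hi, rfl⟩
  · rw [mem_edge_zero, InBlock.zero_iff (by omega)] at hmem
    exact ⟨0, by rw [hmem.2]⟩
  · rw [h.mem_edge_one hi] at hmem
    exact ⟨1, by grind⟩
  · rw [h.mem_edge_two hi] at hmem
    exact ⟨2, by grind⟩

theorem eq_of_last_mem (h : IsGluing k p q l a b) (hb : b = (1, q * (k - 1) - 1))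
    {e : Set (Fin 3 × ℕ)} (he : e ∈ (theta k p q l a b).edgeSet) (hmem : (0, p * (k - 1)) ∈ e) :
    e = thetaEdge k p q l a b 0 (p - 1) ∨ e = thetaEdge k p q l a b 1 (q - 1) := by
  have hK := h.two_le
  have hP := h.two_le_p
  have ha := h.fst_eq
  rcases mem_edgeSet_theta'.1 he with ⟨i, hi, rfl⟩ | ⟨i, hi, rfl⟩ | ⟨i, hi, rfl⟩
  · rw [mem_edge_zero, InBlock.mul_iff (by omega) hi] at hmem
    grind
  · rw [h.mem_edge_one hi] at hmem
    grind
  · rw [h.mem_edge_two hi] at hmem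
    grind

theorem eq_of_snd_mem (h : IsGluing k p q l a b) (hb : b = (1, q * (k - 1) - 1))
    {e : Set (Fin 3 × ℕ)} (he : e ∈ (theta k p q l a b).edgeSet) (hmem : b ∈ e) :
    e = thetaEdge k p q l a b 2 (l - 1) ∨ e = thetaEdge k p q l a b 1 (q - 1) := by
  have hK := h.two_le
  have hne := h.ne
  rcases mem_edgeSet_theta'.1 he with ⟨i, hi, rfl⟩ | ⟨i, hi, rfl⟩ | ⟨i, hi, rfl⟩
  · rw [mem_edge_zero] at hmem
    grind
  · rw [h.mem_edge_one hi, hb, InBlock.pred_iff hK hi] at hmem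
    grind
  · rw [h.mem_edge_two hi] at hmem
    grind

/-- An edge other than the one that contains `b` in its interior meets the other edges in its two
joints only. -/
theorem eq_or_of_mem_of_mem (h : IsGluing k p q l a b) (ha : a = (0, 0)) {j : Fin 3} {i : ℕ}
    (hi : i < ![p, q, l] j) (hub : b = (0, p * (k - 1)) ∨ ¬(j = 1 ∧ i + 1 = q))
    {w : Fin 3 × ℕ} (hw : w ∈ thetaEdge k p q l a b j i) {e : Set (Fin 3 × ℕ)}
    (he : e ∈ (theta k p q l a b).edgeSet) (hne : e ≠ thetaEdge k p q l a b j i) (hwe : w ∈ e) :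
    w = glue k p q l a b (j, i * (k - 1)) ∨ w = glue k p q l a b (j, (i + 1) * (k - 1)) := by
  have hK := h.two_le
  have hb := h.snd_eq
  obtain ⟨x, hx, rfl⟩ := hw
  by_cases h1 : x = i * (k - 1)
  · exact Or.inl (by rw [h1])
  by_cases h2 : x = (i + 1) * (k - 1)
  · exact Or.inr (by rw [h2])
  -- A point strictly inside its block is not renamed and lies in no other edge of its path. Since
  -- `a = (0, 0)`, an edge of another path can contain it only if it is `b`, inside the last block
  -- of the second path; `hub` excludes this.
  exfalso
  have h3 : i * (k - 1) < x := lt_of_le_of_ne hx.1 (Ne.symm h1)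
  have h4 : x < (i + 1) * (k - 1) := lt_of_le_of_ne hx.2 h2
  have h5 : x < ![p, q, l] j * (k - 1) := h4.trans_le (Nat.mul_le_mul_right _ hi)
  rw [glue_of_lt (by omega) h5] at hwe
  have h6 : ∀ i', InBlock (k - 1) i' x → i' = i := fun i' => InBlock.eq_of_lt h3 h4
  have h7 : i < q → x = q * (k - 1) - 1 → i + 1 = q := by
    rintro h7 rfl
    exact (InBlock.pred_iff hK h7).1 hx
  rcases mem_edgeSet_theta'.1 he with ⟨i', hi', rfl⟩ | ⟨i', hi', rfl⟩ | ⟨i', hi', rfl⟩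
  · rw [mem_edge_zero] at hwe
    grind
  · rw [h.mem_edge_one hi'] at hwe
    fin_cases j
    all_goals simp at hwe h5 hne hi
    all_goals grind
  · rw [h.mem_edge_two hi'] at hwe
    fin_cases j
    all_goals simp at hwe h5 hne hi
    all_goals grind

section Linked

variable {S : Set (Set (Fin 3 × ℕ))}

theorem exists_of_isLinked (h : IsGluing k p q l a b) (ha : a = (0, 0))
    (hSE : S ⊆ (theta k p q l a b).edgeSet) (hS : IsLinked S) {j : Fin 3} {i : ℕ}
    (hi : i < ![p, q, l] j) (hub : b = (0, p * (k - 1)) ∨ ¬(j = 1 ∧ i + 1 = q))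
    (hmem : thetaEdge k p q l a b j i ∈ S) :
    (∃ e ∈ S, e ≠ thetaEdge k p q l a b j i ∧ glue k p q l a b (j, i * (k - 1)) ∈ e) ∧
      ∃ e ∈ S, e ≠ thetaEdge k p q l a b j i ∧ glue k p q l a b (j, (i + 1) * (k - 1)) ∈ e :=
  hS.exists_of_forall hmem fun _ hw _ he hne hwe =>
    h.eq_or_of_mem_of_mem ha hi hub hw (hSE he) hne hwe

theorem succ_mem_of_isLinked (h : IsGluing k p q l a b) (ha : a = (0, 0))
    (hSE : S ⊆ (theta k p q l a b).edgeSet) (hS : IsLinked S) {j : Fin 3} {i : ℕ}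
    (hi : i + 1 < ![p, q, l] j)
    (hmem : thetaEdge k p q l a b j i ∈ S) : thetaEdge k p q l a b j (i + 1) ∈ S := by
  have hub : ¬(j = 1 ∧ i + 1 = q) := by
    rintro ⟨rfl, rfl⟩
    simp at hi
  obtain ⟨-, e, he, hne, hwe⟩ := h.exists_of_isLinked ha hSE hS (by omega) (Or.inr hub) hmem
  have hK : 0 < k - 1 := by have := h.two_le; omega
  rw [glue_of_lt (Nat.mul_pos (by omega) hK) (Nat.mul_lt_mul_of_pos_right hi hK)] at hwe
  rcases h.eq_or_of_joint_mem (by omega) hi (hSE he) hwe with rfl | rfl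
  · exact he
  · exact absurd rfl hne

theorem mem_of_succ_mem_of_isLinked (h : IsGluing k p q l a b) (ha : a = (0, 0))
    (hSE : S ⊆ (theta k p q l a b).edgeSet) (hS : IsLinked S) {j : Fin 3} {i : ℕ}
    (hi : i + 1 < ![p, q, l] j) (hub : b = (0, p * (k - 1)) ∨ ¬(j = 1 ∧ i + 1 + 1 = q))
    (hmem : thetaEdge k p q l a b j (i + 1) ∈ S) : thetaEdge k p q l a b j i ∈ S := by
  obtain ⟨⟨e, he, hne, hwe⟩, -⟩ := h.exists_of_isLinked ha hSE hS hi hub hmem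
  have hK : 0 < k - 1 := by have := h.two_le; omega
  rw [glue_of_lt (Nat.mul_pos (by omega) hK) (Nat.mul_lt_mul_of_pos_right hi hK)] at hwe
  rcases h.eq_or_of_joint_mem (by omega) hi (hSE he) hwe with rfl | rfl
  · exact absurd rfl hne
  · exact he

theorem start_of_isLinked (h : IsGluing k p q l a b) (ha : a = (0, 0))
    (hSE : S ⊆ (theta k p q l a b).edgeSet) (hS : IsLinked S) {j : Fin 3}
    (hub : b = (0, p * (k - 1)) ∨ ¬(j = 1 ∧ 0 + 1 = q))
    (hmem : thetaEdge k p q l a b j 0 ∈ S) : ∃ j' ≠ j, thetaEdge k p q l a b j' 0 ∈ S := by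
  have hpos : 0 < ![p, q, l] j := by
    have h1 := h.p_pos
    have h2 := h.q_pos
    have h3 := h.l_pos
    fin_cases j <;> simpa
  obtain ⟨⟨e, he, hne, hwe⟩, -⟩ := h.exists_of_isLinked ha hSE hS hpos hub hmem
  rw [zero_mul, glue_first ha] at hwe
  obtain ⟨j', rfl⟩ := h.eq_of_first_mem (hSE he) hwe
  exact ⟨j', fun hc => hne (by rw [hc]), he⟩

end Linked

end IsGluing

theorem isGluing_one {k p q l : ℕ} (hk : 3 ≤ k) (hp : 0 < p) (hq : 0 < q) (hl : 0 < l) :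
    IsGluing k p q l (0, 0) (0, p * (k - 1)) where
  three_le := hk
  p_pos := hp
  q_pos := hq
  l_pos := hl
  fst_eq := Or.inl rfl
  snd_eq := Or.inl rfl
  ne hc := by
    have := (Prod.ext_iff.1 hc).2
    exact absurd this (Nat.mul_pos hp (by omega : 0 < k - 1)).ne

theorem isGluing_two {k p q l : ℕ} (hk : 3 ≤ k) (hp : 0 < p) (hq : 0 < q) (hl : 0 < l) :
    IsGluing k p q l (0, 0) (1, q * (k - 1) - 1) where
  three_le := hk
  p_pos := hp
  q_pos := hq
  l_pos := hl
  fst_eq := Or.inl rfl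
  snd_eq := Or.inr rfl
  ne hc := by simpa using congrArg Prod.fst hc

theorem isGluing_three {k p q l : ℕ} (hk : 3 ≤ k) (hp : 0 < p) (hq : 0 < q) (hl : 0 < l)
    (hqk : 1 < q ∨ 3 < k) : IsGluing k p q l (1, 1) (1, q * (k - 1) - 1) where
  three_le := hk
  p_pos := hp
  q_pos := hq
  l_pos := hl
  fst_eq := Or.inr rfl
  snd_eq := Or.inr rfl
  ne hc := by
    have h1 := congrArg Prod.snd hc
    simp only at h1
    have h2 : 2 < q * (k - 1) := by
      obtain ⟨K, rfl⟩ := Nat.exists_eq_add_of_le' hk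
      rw [show K + 3 - 1 = K + 2 by omega]
      rcases hqk with h | h <;> nlinarith
    omega

/-! ### The girth of the extremal hypergraphs -/

theorem le_of_isLinked_thetaOne {k h : ℕ} (hk : 3 ≤ k) (hh : 0 < h)
    {S : Set (Set (Fin 3 × ℕ))} (hSE : S ⊆ (thetaOne k h h h).edgeSet) (hfin : S.Finite)
    (hS : IsLinked S) (hne : S.Nonempty) : 2 * h ≤ S.ncard := by
  rw [thetaOne_eq] at hSE
  have hg := isGluing_one (l := h) hk hh hh hh
  have hlen : ∀ j, ![h, h, h] j = h := by
    intro j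
    fin_cases j <;> rfl
  refine two_mul_le_ncard hfin (arm := thetaEdge k h h h (0, 0) (0, h * (k - 1)))
    (fun j i j' i' hi hi' heq => ?_) (fun j i hi => ?_) (fun j i hi => ?_) (fun j _ => ?_) ?_
  · exact hg.thetaEdge_inj (by rwa [hlen]) (by rwa [hlen]) heq
  · exact hg.succ_mem_of_isLinked rfl hSE hS (by rwa [hlen])
  · exact hg.mem_of_succ_mem_of_isLinked rfl hSE hS (by rwa [hlen]) (Or.inl rfl)
  · exact hg.start_of_isLinked rfl hSE hS (Or.inl rfl)
  · obtain ⟨e, he⟩ := hne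
    obtain ⟨j, i, hi, rfl⟩ := mem_edgeSet_theta.1 (hSE he)
    exact ⟨j, i, by rwa [hlen] at hi, he⟩

/-- The last edge of the second path acts as a hub: without it there remain three arms of length `h`
with a common start, each ending at its own vertex of the hub. A linked set needs the hub and two
full arms. -/
theorem le_of_isLinked_thetaTwo {k h : ℕ} (hk : 3 ≤ k) (hh : 0 < h)
    {S : Set (Set (Fin 3 × ℕ))} (hSE : S ⊆ (thetaTwo k h (h + 1) h).edgeSet) (hfin : S.Finite)
    (hS : IsLinked S) (hne : S.Nonempty) : 2 * h + 1 ≤ S.ncard := by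
  rw [thetaTwo_eq] at hSE
  have hg := isGluing_two (q := h + 1) (l := h) hk hh (by omega) hh
  have hlen : ∀ j, h ≤ ![h, h + 1, h] j := by
    intro j
    fin_cases j <;> simp
  set b : Fin 3 × ℕ := (1, (h + 1) * (k - 1) - 1) with hb
  have hub1 : h < ![h, h + 1, h] 1 := Nat.lt_succ_self h
  have hneq : ∀ j, ∀ i < h, thetaEdge k h (h + 1) h (0, 0) b j i ≠
      thetaEdge k h (h + 1) h (0, 0) b 1 h := fun j i hi hc => by
    have := (hg.thetaEdge_inj (hi.trans_le (hlen j)) hub1 hc).2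
    omega
  have hcases : ∀ e ∈ S, e = thetaEdge k h (h + 1) h (0, 0) b 1 h ∨
      ∃ j, ∃ i < h, e = thetaEdge k h (h + 1) h (0, 0) b j i := by
    intro e he
    rcases mem_edgeSet_theta'.1 (hSE he) with ⟨i, hi, rfl⟩ | ⟨i, hi, rfl⟩ | ⟨i, hi, rfl⟩
    · exact Or.inr ⟨0, i, hi, rfl⟩
    · rcases (Nat.lt_succ_iff.1 hi).eq_or_lt with rfl | hi
      · exact Or.inl rfl
      · exact Or.inr ⟨1, i, hi, rfl⟩
    · exact Or.inr ⟨2, i, hi, rfl⟩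
  have up : ∀ j i, i + 1 < h → thetaEdge k h (h + 1) h (0, 0) b j i ∈ S →
      thetaEdge k h (h + 1) h (0, 0) b j (i + 1) ∈ S := fun j i hi =>
    hg.succ_mem_of_isLinked rfl hSE hS (hi.trans_le (hlen j))
  have down : ∀ j i, i + 1 < h → thetaEdge k h (h + 1) h (0, 0) b j (i + 1) ∈ S →
      thetaEdge k h (h + 1) h (0, 0) b j i ∈ S := fun j i hi =>
    hg.mem_of_succ_mem_of_isLinked rfl hSE hS (hi.trans_le (hlen j)) (Or.inr (by omega))
  -- The hub alone is not linked, so some arm edge occurs.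
  have hex : ∃ j, ∃ i < h, thetaEdge k h (h + 1) h (0, 0) b j i ∈ S := by
    obtain ⟨e, he⟩ := hne
    rcases hcases e he with rfl | ⟨j, i, hi, rfl⟩
    · obtain ⟨u, -, v, -, -, ⟨e', he', hne', -⟩, -⟩ := hS _ he
      rcases hcases e' he' with rfl | ⟨j, i, hi, rfl⟩
      · exact absurd rfl hne'
      · exact ⟨j, i, hi, he'⟩
    · exact ⟨j, i, hi, he⟩
  -- The arm is contained up to its top edge, whose outer joint lies in no other edge than the hub.
  have hubS : thetaEdge k h (h + 1) h (0, 0) b 1 h ∈ S := by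
    obtain ⟨j, i, hi, hmem⟩ := hex
    have htop := forall_arm_mem (up j) (down j) hi hmem (h - 1) (by omega)
    have hlt : h - 1 < ![h, h + 1, h] j := by have := hlen j; omega
    obtain ⟨-, e, he, hne', hwe⟩ := hg.exists_of_isLinked rfl hSE hS hlt (Or.inr (by omega)) htop
    rw [Nat.sub_add_cancel (by omega)] at hwe
    fin_cases j
    · have h1 : (0, h * (k - 1)) ∈ e := by simpa [glue] using hwe
      rcases hg.eq_of_last_mem hb (hSE he) h1 with rfl | rfl
      · exact absurd rfl hne'
      · exact he
    · have h1 := hg.succ_mem_of_isLinked rfl hSE hS (j := 1) (i := h - 1)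
        (show h - 1 + 1 < h + 1 by omega) htop
      rwa [Nat.sub_add_cancel (by omega)] at h1
    · have h1 : b ∈ e := by rw [← hg.glue_last_two]; exact hwe
      rcases hg.eq_of_snd_mem hb (hSE he) h1 with rfl | rfl
      · exact absurd rfl hne'
      · exact he
  -- Removing the hub from `S` keeps the closure properties along the arms and at their common
  -- start, so the count of two arms still applies.
  have h2 : 2 * h ≤ (S \ {thetaEdge k h (h + 1) h (0, 0) b 1 h}).ncard := by
    refine two_mul_le_ncard hfin.sdiff (arm := thetaEdge k h (h + 1) h (0, 0) b)
      (fun j i j' i' hi hi' heq => ?_) (fun j i hi hm => ?_) (fun j i hi hm => ?_)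
      (fun j h0 hm => ?_) ?_
    · exact hg.thetaEdge_inj (hi.trans_le (hlen _)) (hi'.trans_le (hlen _)) heq
    · exact ⟨up j i hi hm.1, hneq j _ hi⟩
    · exact ⟨down j i hi hm.1, hneq j _ (by omega)⟩
    · obtain ⟨j', hj', hm'⟩ := hg.start_of_isLinked rfl hSE hS (Or.inr (by omega)) hm.1
      exact ⟨j', hj', hm', hneq j' 0 h0⟩
    · obtain ⟨j, i, hi, hmem⟩ := hex
      exact ⟨j, i, hi, hmem, hneq j i hi⟩
  have h3 := Set.ncard_sdiff_singleton_add_one hubS hfin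
  omega

theorem hasGirth_thetaOneAttach {k h t : ℕ} (hk : 3 ≤ k) (hh : 0 < h) :
    (thetaOneAttach k h h h t).HasGirth (2 * h) := by
  constructor
  · have := (isGluing_one (l := h) hk hh hh hh).hasHypercycle
    rw [← thetaOne_eq, ← two_mul] at this
    exact (this.image Sum.inl_injective.injOn).mono (edgeSet_image_inl_subset _ _ _ _)
  · intro L hL
    obtain ⟨S, hSE, hfin, rfl, hS⟩ := exists_isLinked_of_attachPendant hL
    exact le_of_isLinked_thetaOne hk hh hSE hfin hS
      (Set.nonempty_of_ncard_ne_zero (by have := hL.1; omega))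

theorem hasGirth_thetaTwoAttach {k h t : ℕ} (hk : 3 ≤ k) (hh : 0 < h) :
    (thetaTwoAttach k h (h + 1) h t).HasGirth (2 * h + 1) := by
  constructor
  · have := (isGluing_two (q := h + 1) (l := h) hk hh (by omega) hh).hasHypercycle
    rw [← thetaTwo_eq, ← add_assoc, ← two_mul] at this
    exact (this.image Sum.inl_injective.injOn).mono (edgeSet_image_inl_subset _ _ _ _)
  · intro L hL
    obtain ⟨S, hSE, hfin, rfl, hS⟩ := exists_isLinked_of_attachPendant hL
    exact le_of_isLinked_thetaTwo hk hh hSE hfin hS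
      (Set.nonempty_of_ncard_ne_zero (by have := hL.1; omega))

/-! ### The symmetry exchanging the two vertices of degree three -/

/-- The reversal of three paths of length `h`. -/
def reversal (k h : ℕ) (v : Fin 3 × ℕ) : Fin 3 × ℕ := (v.1, h * (k - 1) - v.2)

theorem injOn_reversal {k h : ℕ} (hk : 3 ≤ k) (hh : 0 < h) :
    (thetaOne k h h h).vertexSet.InjOn (reversal k h) := by
  rw [thetaOne_eq, (isGluing_one (l := h) hk hh hh hh).vertexSet]
  intro v hv w hw heq
  simp only [reversal, Prod.mk.injEq, Set.mem_ofPred_eq] at hv hw heq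
  refine Prod.ext heq.1 ?_
  omega

theorem reversal_glue {k h x : ℕ} (hk : 3 ≤ k) (hh : 0 < h) (hx : x ≤ h * (k - 1)) (j : Fin 3) :
    reversal k h (glue k h h h (0, 0) (0, h * (k - 1)) (j, x)) =
      glue k h h h (0, 0) (0, h * (k - 1)) (j, h * (k - 1) - x) := by
  have := (isGluing_one (l := h) hk hh hh hh).two_le_p
  unfold reversal
  rw [glue, glue]
  fin_cases j <;> grind

theorem InBlock.reverse {K h i x : ℕ} (hi : i < h) (hb : InBlock K i x) :
    InBlock K (h - 1 - i) (h * K - x) := by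
  obtain ⟨r, rfl⟩ : ∃ r, h = i + 1 + r := ⟨h - (i + 1), by omega⟩
  rw [show i + 1 + r - 1 - i = r by omega]
  have h1 := hb.1
  have h2 := hb.2
  have h3 : (i + 1 + r) * K = i * K + K + r * K := by ring
  have h4 : (i + 1) * K = i * K + K := by ring
  have h5 : (r + 1) * K = r * K + K := by ring
  constructor <;> omega

theorem reversal_image_thetaEdge {k h i : ℕ} (hk : 3 ≤ k) (hi : i < h) (j : Fin 3) :
    reversal k h '' thetaEdge k h h h (0, 0) (0, h * (k - 1)) j i =
      thetaEdge k h h h (0, 0) (0, h * (k - 1)) j (h - 1 - i) := by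
  have hh : 0 < h := by omega
  apply Set.Subset.antisymm
  · rintro _ ⟨_, ⟨x, hx, rfl⟩, rfl⟩
    rw [reversal_glue hk hh (hx.le_mul hi)]
    exact ⟨_, hx.reverse hi, rfl⟩
  · rintro _ ⟨x, hx, rfl⟩
    have hlt : h - 1 - i < h := by omega
    have hle := hx.le_mul hlt
    refine ⟨_, ⟨h * (k - 1) - x, ?_, rfl⟩, ?_⟩
    · have := hx.reverse hlt
      rwa [show h - 1 - (h - 1 - i) = i by omega] at this
    · rw [reversal_glue hk hh (by omega), Nat.sub_sub_self hle]

/-- Reversal sends block `i` to block `h - 1 - i` on each path and swaps the two common ends. Hence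
pendant edges at either end give isomorphic hypergraphs. -/
theorem reversal_image {k h : ℕ} (hk : 3 ≤ k) (hh : 0 < h) :
    (thetaOne k h h h).image (reversal k h) = thetaOne k h h h := by
  have hlen : ∀ j, ![h, h, h] j = h := by
    intro j
    fin_cases j <;> rfl
  rw [thetaOne_eq]
  have hg := isGluing_one (l := h) hk hh hh hh
  refine Hypergraph.ext ?_ ?_
  · have hP := hg.two_le_p
    rw [image_vertexSet, hg.vertexSet]
    ext v
    constructor
    · rintro ⟨w, hw, rfl⟩
      simp only [reversal, Set.mem_ofPred_eq] at hw ⊢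
      omega
    · intro hv
      refine ⟨reversal k h v, ?_, ?_⟩
      · simp only [reversal, Set.mem_ofPred_eq] at hv ⊢
        omega
      · simp only [reversal, Set.mem_ofPred_eq] at hv ⊢
        refine Prod.ext rfl ?_
        simp only
        omega
  · ext e
    constructor
    · rintro ⟨e', he', rfl⟩
      obtain ⟨j, i, hi, rfl⟩ := mem_edgeSet_theta.1 he'
      rw [hlen] at hi
      rw [reversal_image_thetaEdge hk hi]
      exact mem_edgeSet_theta.2 ⟨j, _, by rw [hlen]; omega, rfl⟩
    · intro he
      obtain ⟨j, i, hi, rfl⟩ := mem_edgeSet_theta.1 he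
      rw [hlen] at hi
      refine ⟨_, mem_edgeSet_theta.2 ⟨j, h - 1 - i, by rw [hlen]; omega, rfl⟩, ?_⟩
      rw [reversal_image_thetaEdge hk (by omega), show h - 1 - (h - 1 - i) = i by omega]

/-! ### Zagreb indices and degrees of the three theta families -/

theorem zagreb_thetaOne {k p q l : ℕ} (hk : 3 ≤ k) (hp : 0 < p) (hq : 0 < q) (hl : 0 < l) :
    (thetaOne k p q l).zagreb = (p + q + l) * (k + 2) + 6 := by
  have hg := isGluing_one hk hp hq hl
  have hne : ((0, 0) : Fin 3 × ℕ) ≠ (0, p * (k - 1)) := hg.ne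
  rw [thetaOne_eq, hg.zagreb {(0, 0), (0, p * (k - 1))}, Finset.card_pair hne]
  · intro v hv
    rcases Finset.mem_insert.1 hv with rfl | hv
    · exact ⟨hg.first_mem, hg.degree_first rfl⟩
    · rw [Finset.mem_singleton.1 hv]
      exact ⟨hg.last_mem, hg.degree_last rfl⟩
  · intro v hv
    simp only [Finset.mem_insert, Finset.mem_singleton, not_or] at hv
    exact hg.degree_le_two (fun _ => hv.1) (fun _ => hv.2)

theorem zagreb_thetaTwo {k p q l : ℕ} (hk : 3 ≤ k) (hp : 0 < p) (hq : 0 < q) (hl : 0 < l) :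
    (thetaTwo k p q l).zagreb = (p + q + l) * (k + 2) + 4 := by
  have hg := isGluing_two hk hp hq hl
  rw [thetaTwo_eq, hg.zagreb {(0, 0)}, Finset.card_singleton]
  · intro v hv
    rw [Finset.mem_singleton.1 hv]
    exact ⟨hg.first_mem, hg.degree_first rfl⟩
  · intro v hv
    rw [Finset.mem_singleton] at hv
    exact hg.degree_le_two (fun _ => hv) (by rintro rfl; simp)

theorem degree_thetaThree_le {k p q l : ℕ} (hk : 3 ≤ k) (hp : 0 < p) (hq : 0 < q) (hl : 0 < l)
    (hqk : 1 < q ∨ 3 < k) (v : Fin 3 × ℕ) : (thetaThree k p q l).degree v ≤ 2 := by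
  rw [thetaThree_eq]
  exact (isGluing_three hk hp hq hl hqk).degree_le_two (by rintro rfl; simp) (by rintro rfl; simp)

theorem zagreb_thetaThree {k p q l : ℕ} (hk : 3 ≤ k) (hp : 0 < p) (hq : 0 < q) (hl : 0 < l)
    (hqk : 1 < q ∨ 3 < k) : (thetaThree k p q l).zagreb = (p + q + l) * (k + 2) + 2 := by
  have hdeg := degree_thetaThree_le hk hp hq hl hqk
  rw [thetaThree_eq] at *
  rw [(isGluing_three hk hp hq hl hqk).zagreb ∅ (by simp) fun v _ => hdeg v]
  rfl

theorem degree_thetaOne_eq_three {k p q l : ℕ} (hk : 3 ≤ k) (hp : 0 < p) (hq : 0 < q)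
    (hl : 0 < l) (v : Fin 3 × ℕ) :
    (thetaOne k p q l).degree v ≤ 3 ∧
      ((thetaOne k p q l).degree v = 3 → v = (0, 0) ∨ v = (0, p * (k - 1))) := by
  have hg := isGluing_one hk hp hq hl
  rw [thetaOne_eq]
  by_cases h0 : v = (0, 0)
  · exact ⟨by rw [h0, hg.degree_first rfl], fun _ => Or.inl h0⟩
  by_cases h1 : v = (0, p * (k - 1))
  · exact ⟨by rw [h1, hg.degree_last rfl], fun _ => Or.inr h1⟩
  have := hg.degree_le_two (v := v) (fun _ => h0) (fun _ => h1)
  exact ⟨by omega, fun h => by omega⟩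

theorem degree_thetaTwo_eq_three {k p q l : ℕ} (hk : 3 ≤ k) (hp : 0 < p) (hq : 0 < q)
    (hl : 0 < l) (v : Fin 3 × ℕ) :
    (thetaTwo k p q l).degree v ≤ 3 ∧ ((thetaTwo k p q l).degree v = 3 → v = (0, 0)) := by
  have hg := isGluing_two hk hp hq hl
  rw [thetaTwo_eq]
  by_cases h0 : v = (0, 0)
  · exact ⟨by rw [h0, hg.degree_first rfl], fun _ => h0⟩
  have := hg.degree_le_two (v := v) (fun _ => h0) (by rintro rfl; simp)
  exact ⟨by omega, fun h => by omega⟩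

/-! ### Bicyclic hypergraphs containing a theta copy -/

section Copy

variable {α : Type*} {H : Hypergraph α} {k n m p q l : ℕ} {a b : Fin 3 × ℕ} {f : Fin 3 × ℕ → α}

theorem IsGluing.isCore (hg : IsGluing k p q l a b)
    (hf : (theta k p q l a b).vertexSet.InjOn f)
    (hV : ((theta k p q l a b).image f).vertexSet ⊆ H.vertexSet)
    (hE : ((theta k p q l a b).image f).edgeSet ⊆ H.edgeSet) :
    ((theta k p q l a b).image f).IsCore H k (p + q + l) where
  vertexSet_subset := hV
  edgeSet_subset := hE
  ncard_vertexSet := by rw [ncard_vertexSet_image _ hf, hg.ncard_vertexSet]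
  ncard_edgeSet := by rw [ncard_edgeSet_image _ hf, hg.ncard_edgeSet]

theorem IsGluing.add_le (hg : IsGluing k p q l a b) (h : H.IsBicyclic k n m)
    (hc : H.ContainsCopy (theta k p q l a b)) : p + q + l ≤ m := by
  obtain ⟨f, hf, hV, hE⟩ := hc
  exact (hg.isCore hf hV hE).le_card h

theorem IsGluing.le_of_hasGirth (hg : IsGluing k p q l a b)
    (hc : H.ContainsCopy (theta k p q l a b)) {g : ℕ} (hgirth : H.HasGirth g) : g ≤ p + q := by
  obtain ⟨f, hf, hV, hE⟩ := hc
  exact hgirth.2 ((hg.hasHypercycle.image hf).mono hE)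

theorem IsBicyclic.two_le (h : H.IsBicyclic k n m) (hk : 3 ≤ k) (hm : 2 ≤ m) : 2 ≤ n := by
  have h1 := h.bicyclic
  zify at *
  nlinarith

/-- With maximum core degree `B + 2`, the main term becomes `m * (k + 2)`, independent of `c`, so
bounds for different cores can be compared through `m - c` alone. -/
theorem arrange_zagreb {k m c : ℕ} (hk : 1 ≤ k) (hc : c ≤ m) (r B : ℕ) :
    c * (k + 2) + r + (m - c) * (k - 1) + 2 * (B + 2) * (m - c) + (m - c) ^ 2 =
      m * (k + 2) + r + (2 * B + 1) * (m - c) + (m - c) ^ 2 := by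
  obtain ⟨s, rfl⟩ := Nat.exists_eq_add_of_le hc
  obtain ⟨K, rfl⟩ := Nat.exists_eq_add_of_le' hk
  simp only [Nat.add_sub_cancel_left, Nat.add_sub_cancel]
  ring

theorem IsGluing.zagreb_le (hg : IsGluing k p q l a b) (h : H.IsBicyclic k n m)
    (hc : H.ContainsCopy (theta k p q l a b)) {r B : ℕ}
    (hz : (theta k p q l a b).zagreb = (p + q + l) * (k + 2) + r)
    (hdeg : ∀ v, (theta k p q l a b).degree v ≤ B + 2) :
    H.zagreb ≤ m * (k + 2) + r + (2 * B + 1) * (m - (p + q + l)) + (m - (p + q + l)) ^ 2 := by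
  have hk := hg.three_le
  have hm := hg.add_le h hc
  obtain ⟨f, hf, hV, hE⟩ := hc
  have h1 := hg.p_pos
  have h2 := hg.q_pos
  have := (hg.isCore hf hV hE).zagreb_le h (by omega) (h.two_le hk (by omega)) (B := B + 2)
    (by omega) (by
      rintro _ ⟨v, hv, rfl⟩
      rw [degree_image _ hf hv]
      exact hdeg v)
  rwa [zagreb_image _ hf, hz, arrange_zagreb (by omega) hm] at this

/-- Equality attaches all pendant edges at some vertex `v` of maximum degree. The symmetry `ρ` moves
`(0, 0)` to `v`, so precomposing the copy with `ρ` lets them be attached at `(0, 0)`. -/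
theorem IsGluing.isIso_of_zagreb_eq (hg : IsGluing k p q l a b) (h : H.IsBicyclic k n m)
    (hc : H.ContainsCopy (theta k p q l a b)) {r B : ℕ}
    (hz : (theta k p q l a b).zagreb = (p + q + l) * (k + 2) + r)
    (hdeg : ∀ v, (theta k p q l a b).degree v ≤ B + 2)
    (hex : ∃ v ∈ (theta k p q l a b).vertexSet, (theta k p q l a b).degree v = B + 2)
    (heq : H.zagreb =
      m * (k + 2) + r + (2 * B + 1) * (m - (p + q + l)) + (m - (p + q + l)) ^ 2)
    (hsymm : ∀ v ∈ (theta k p q l a b).vertexSet, (theta k p q l a b).degree v = B + 2 →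
      ∃ ρ : Fin 3 × ℕ → Fin 3 × ℕ, (theta k p q l a b).vertexSet.InjOn ρ ∧
        (theta k p q l a b).image ρ = theta k p q l a b ∧ ρ (0, 0) = v) :
    ((theta k p q l a b).attachPendant (0, 0) k (m - (p + q + l))).IsIso H := by
  have hk := hg.three_le
  have hm := hg.add_le h hc
  obtain ⟨f, hf, hV, hE⟩ := hc
  have h1 := hg.p_pos
  have h2 := hg.q_pos
  have hcore := hg.isCore hf hV hE
  rw [← arrange_zagreb (by omega) hm, ← hz, ← zagreb_image _ hf] at heq
  obtain ⟨_, ⟨v, hv, rfl⟩, hvB, hall⟩ := hcore.degree_of_zagreb_eq h (by omega)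
    (h.two_le hk (by omega)) (by omega) (by
      rintro _ ⟨v, hv, rfl⟩
      rw [degree_image _ hf hv]
      exact hdeg v) (by
      obtain ⟨v, hv, hvB⟩ := hex
      exact ⟨f v, ⟨v, hv, rfl⟩, by rw [degree_image _ hf hv, hvB]⟩) heq
  rw [degree_image _ hf hv] at hvB
  obtain ⟨ρ, hρ, himage, rfl⟩ := hsymm v hv hvB
  have himage' : (theta k p q l a b).image (f ∘ ρ) = (theta k p q l a b).image f := by
    rw [← image_image, himage]
  have hmaps : Set.MapsTo ρ (theta k p q l a b).vertexSet (theta k p q l a b).vertexSet := by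
    intro w hw
    have : ρ w ∈ ((theta k p q l a b).image ρ).vertexSet := ⟨w, hw, rfl⟩
    rwa [himage] at this
  refine isIso_attachPendant_of_degree (hf.comp hρ hmaps) hg.first_mem
    (by rwa [himage']) h fun w hw => ?_
  rw [himage']
  exact hall w hw

theorem IsGluing.isBicyclic_attachPendant (hg : IsGluing k p q l a b) (ha : a = (0, 0))
    (hm : p + q + l ≤ m) (hn : (n : ℤ) = m * ((k : ℤ) - 1) - 1) :
    ((theta k p q l a b).attachPendant (0, 0) k (m - (p + q + l))).IsBicyclic k n m :=
  Hypergraph.isBicyclic_attachPendant _ (by have := hg.three_le; omega) hg.first_mem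
    (hg.isConnected ha) hg.isUniform (IsGluing.finite_vertexSet _ _ _ _ _ _)
    (IsGluing.finite_edgeSet _ _ _ _ _ _) hg.ncard_vertexSet hg.ncard_edgeSet hm hn

theorem IsGluing.zagreb_attachPendant (hg : IsGluing k p q l a b) (ha : a = (0, 0))
    (hm : p + q + l ≤ m) {r : ℕ}
    (hz : (theta k p q l a b).zagreb = (p + q + l) * (k + 2) + r) :
    ((theta k p q l a b).attachPendant (0, 0) k (m - (p + q + l))).zagreb =
      m * (k + 2) + r + 3 * (m - (p + q + l)) + (m - (p + q + l)) ^ 2 := by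
  have hk := hg.three_le
  rw [Hypergraph.zagreb_attachPendant _ (IsGluing.finite_vertexSet _ _ _ _ _ _)
    (IsGluing.finite_edgeSet _ _ _ _ _ _) (by omega) hg.first_mem, hg.degree_first ha, hz]
  exact arrange_zagreb (by omega) hm r 1

end Copy

/-! ### Comparison of the bounds -/

theorem ThetaOneLengths.pos {p q l : ℕ} (h : ThetaOneLengths p q l) : 0 < p ∧ 0 < q ∧ 0 < l := by
  unfold ThetaOneLengths at h
  omega

theorem ThetaTwoLengths.pos {p q l : ℕ} (h : ThetaTwoLengths p q l) : 0 < p ∧ 0 < q ∧ 0 < l := by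
  unfold ThetaTwoLengths at h
  omega

theorem ThetaThreeLengths.pos {k p q l : ℕ} (h : ThetaThreeLengths k p q l) :
    0 < p ∧ 0 < q ∧ 0 < l ∧ (1 < q ∨ 3 < k) := by
  unfold ThetaThreeLengths at h
  omega

section Bounds

variable {k n m p q l : ℕ}

theorem zagreb_thetaOneAttach (hk : 3 ≤ k) (hp : 0 < p) (hq : 0 < q) (hl : 0 < l)
    (hm : p + q + l ≤ m) : (thetaOneAttach k p q l (m - (p + q + l))).zagreb =
      m * (k + 2) + 6 + 3 * (m - (p + q + l)) + (m - (p + q + l)) ^ 2 := by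
  have hz := zagreb_thetaOne hk hp hq hl
  rw [thetaOne_eq] at hz
  rw [thetaOneAttach, thetaOne_eq]
  exact (isGluing_one hk hp hq hl).zagreb_attachPendant rfl hm hz

theorem zagreb_thetaTwoAttach (hk : 3 ≤ k) (hp : 0 < p) (hq : 0 < q) (hl : 0 < l)
    (hm : p + q + l ≤ m) : (thetaTwoAttach k p q l (m - (p + q + l))).zagreb =
      m * (k + 2) + 4 + 3 * (m - (p + q + l)) + (m - (p + q + l)) ^ 2 := by
  have hz := zagreb_thetaTwo hk hp hq hl
  rw [thetaTwo_eq] at hz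
  rw [thetaTwoAttach, thetaTwo_eq]
  exact (isGluing_two hk hp hq hl).zagreb_attachPendant rfl hm hz

theorem isThetaBicyclic_thetaOneAttach (hk : 3 ≤ k) (hL : ThetaOneLengths p q l)
    (hm : p + q + l ≤ m) (hn : (n : ℤ) = m * ((k : ℤ) - 1) - 1) :
    (thetaOneAttach k p q l (m - (p + q + l))).IsThetaBicyclic k n m := by
  obtain ⟨hp, hq, hl⟩ := hL.pos
  refine ⟨?_, p, q, l, Or.inl ⟨hL, attachPendant_containsCopy _ _ _ _⟩⟩
  rw [thetaOneAttach, thetaOne_eq]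
  exact (isGluing_one hk hp hq hl).isBicyclic_attachPendant rfl hm hn

theorem isThetaBicyclic_thetaTwoAttach (hk : 3 ≤ k) (hL : ThetaTwoLengths p q l)
    (hm : p + q + l ≤ m) (hn : (n : ℤ) = m * ((k : ℤ) - 1) - 1) :
    (thetaTwoAttach k p q l (m - (p + q + l))).IsThetaBicyclic k n m := by
  obtain ⟨hp, hq, hl⟩ := hL.pos
  refine ⟨?_, p, q, l, Or.inr (Or.inl ⟨hL, attachPendant_containsCopy _ _ _ _⟩)⟩
  rw [thetaTwoAttach, thetaTwo_eq]
  exact (isGluing_two hk hp hq hl).isBicyclic_attachPendant rfl hm hn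

variable {α : Type*} {H : Hypergraph α}

theorem isIso_thetaOneAttach {h : ℕ} (hk : 3 ≤ k) (hh : 0 < h) (hH : H.IsBicyclic k n m)
    (hc : H.ContainsCopy (thetaOne k h h h))
    (heq : H.zagreb = m * (k + 2) + 6 + 3 * (m - (h + h + h)) + (m - (h + h + h)) ^ 2) :
    (thetaOneAttach k h h h (m - (h + h + h))).IsIso H := by
  have hz := zagreb_thetaOne hk hh hh hh
  have hdeg := degree_thetaOne_eq_three hk hh hh hh
  have hinj := injOn_reversal hk hh
  have himage := reversal_image hk hh
  rw [thetaOneAttach]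
  rw [thetaOne_eq] at *
  have hg := isGluing_one hk hh hh hh
  refine hg.isIso_of_zagreb_eq (B := 1) hH hc hz (fun v => (hdeg v).1)
    ⟨_, hg.first_mem, hg.degree_first rfl⟩ heq fun v hv hv3 => ?_
  rcases (hdeg v).2 hv3 with rfl | rfl
  · exact ⟨id, Set.injOn_id _, by ext <;> simp, rfl⟩
  · exact ⟨reversal k h, hinj, himage, rfl⟩

theorem isIso_thetaTwoAttach (hk : 3 ≤ k) (hp : 0 < p) (hq : 0 < q) (hl : 0 < l)
    (hH : H.IsBicyclic k n m) (hc : H.ContainsCopy (thetaTwo k p q l))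
    (heq : H.zagreb = m * (k + 2) + 4 + 3 * (m - (p + q + l)) + (m - (p + q + l)) ^ 2) :
    (thetaTwoAttach k p q l (m - (p + q + l))).IsIso H := by
  have hz := zagreb_thetaTwo hk hp hq hl
  have hdeg := degree_thetaTwo_eq_three hk hp hq hl
  rw [thetaTwoAttach]
  rw [thetaTwo_eq] at *
  have hg := isGluing_two hk hp hq hl
  refine hg.isIso_of_zagreb_eq (B := 1) hH hc hz (fun v => (hdeg v).1)
    ⟨_, hg.first_mem, hg.degree_first rfl⟩ heq fun v hv hv3 => ?_
  obtain rfl := (hdeg v).2 hv3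
  exact ⟨id, Set.injOn_id _, by ext <;> simp, rfl⟩

/-- The number of edges, the girth and the Zagreb index of a hypergraph that contains a copy of
one of the three theta hypergraphs. -/
theorem IsThetaBicyclic.cases (hk : 3 ≤ k) (hH : H.IsThetaBicyclic k n m) :
    ∃ p q l, p + q + l ≤ m ∧ (∀ g, H.HasGirth g → g ≤ p + q) ∧
      ((ThetaOneLengths p q l ∧ H.ContainsCopy (thetaOne k p q l) ∧
        H.zagreb ≤ m * (k + 2) + 6 + 3 * (m - (p + q + l)) + (m - (p + q + l)) ^ 2) ∨
      (ThetaTwoLengths p q l ∧ H.ContainsCopy (thetaTwo k p q l) ∧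
        H.zagreb ≤ m * (k + 2) + 4 + 3 * (m - (p + q + l)) + (m - (p + q + l)) ^ 2) ∨
      (ThetaThreeLengths k p q l ∧
        H.zagreb ≤ m * (k + 2) + 2 + (m - (p + q + l)) + (m - (p + q + l)) ^ 2)) := by
  obtain ⟨hB, p, q, l, ⟨hL, hc⟩ | ⟨hL, hc⟩ | ⟨hL, hc⟩⟩ := hH
  · obtain ⟨hp, hq, hl⟩ := hL.pos
    have hz := zagreb_thetaOne hk hp hq hl
    have hdeg := fun v => (degree_thetaOne_eq_three hk hp hq hl v).1
    have hg := isGluing_one hk hp hq hl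
    have hc' := hc
    rw [thetaOne_eq] at hc' hz
    simp_rw [thetaOne_eq] at hdeg
    exact ⟨p, q, l, hg.add_le hB hc', fun g => hg.le_of_hasGirth hc',
      Or.inl ⟨hL, hc, hg.zagreb_le (B := 1) hB hc' hz hdeg⟩⟩
  · obtain ⟨hp, hq, hl⟩ := hL.pos
    have hz := zagreb_thetaTwo hk hp hq hl
    have hdeg := fun v => (degree_thetaTwo_eq_three hk hp hq hl v).1
    have hg := isGluing_two hk hp hq hl
    have hc' := hc
    rw [thetaTwo_eq] at hc' hz
    simp_rw [thetaTwo_eq] at hdeg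
    exact ⟨p, q, l, hg.add_le hB hc', fun g => hg.le_of_hasGirth hc',
      Or.inr (Or.inl ⟨hL, hc, hg.zagreb_le (B := 1) hB hc' hz hdeg⟩)⟩
  · obtain ⟨hp, hq, hl, hqk⟩ := hL.pos
    have hz := zagreb_thetaThree hk hp hq hl hqk
    have hdeg := degree_thetaThree_le hk hp hq hl hqk
    have hg := isGluing_three hk hp hq hl hqk
    rw [thetaThree_eq] at hc hz hdeg
    have := hg.zagreb_le (B := 0) hB hc hz hdeg
    rw [mul_zero, zero_add, one_mul] at this
    exact ⟨p, q, l, hg.add_le hB hc, fun g => hg.le_of_hasGirth hc, Or.inr (Or.inr ⟨hL, this⟩)⟩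

theorem zagreb_le_of_even_girth {h : ℕ} (hk : 3 ≤ k) (hh : 0 < h) (hm : h + h + h ≤ m)
    (hH : H.IsThetaBicyclic k n m) (hg : H.HasGirth (2 * h)) :
    H.zagreb ≤ m * (k + 2) + 6 + 3 * (m - (h + h + h)) + (m - (h + h + h)) ^ 2 ∧
      (H.zagreb = m * (k + 2) + 6 + 3 * (m - (h + h + h)) + (m - (h + h + h)) ^ 2 →
        (thetaOneAttach k h h h (m - (h + h + h))).IsIso H) := by
  obtain ⟨p, q, l, hle, hgirth, hcases⟩ := hH.cases hk
  have hpq := hgirth _ hg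
  rcases hcases with ⟨hL, hc, hz⟩ | ⟨hL, -, hz⟩ | ⟨hL, hz⟩
  · unfold ThetaOneLengths at hL
    -- From `2 * h ≤ p + q` and `p ≤ q ≤ l` follow `h ≤ q` and `h ≤ l`, hence `3 * h ≤ p + q + l`,
    -- with equality only for `p = q = l = h`.
    have hs : m - (p + q + l) ≤ m - (h + h + h) := by omega
    refine ⟨by nlinarith, fun heq => ?_⟩
    have hs' : m - (h + h + h) ≤ m - (p + q + l) := by
      by_contra! hlt
      nlinarith
    obtain ⟨rfl, rfl, rfl⟩ : p = h ∧ q = h ∧ l = h := by omega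
    exact isIso_thetaOneAttach hk hh hH.1 hc heq
  · unfold ThetaTwoLengths at hL
    have hs : m - (p + q + l) ≤ m - (h + h + h) := by omega
    have : H.zagreb < m * (k + 2) + 6 + 3 * (m - (h + h + h)) + (m - (h + h + h)) ^ 2 := by
      nlinarith
    exact ⟨this.le, fun heq => absurd heq this.ne⟩
  · unfold ThetaThreeLengths at hL
    -- The third family may save one edge, but with `s = m - 3 * h` its bound `2 + (s + 1) + (s + 1)
    -- ^ 2 = 4 + 3 * s + s ^ 2` still falls short of `6 + 3 * s + s ^ 2`.
    have hs : m - (p + q + l) ≤ m - (h + h + h) + 1 := by omega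
    have : H.zagreb < m * (k + 2) + 6 + 3 * (m - (h + h + h)) + (m - (h + h + h)) ^ 2 := by
      nlinarith
    exact ⟨this.le, fun heq => absurd heq this.ne⟩

/-- The bound for girth `2 h + 1`; for `h = 1` the girth of `H` is arbitrary. -/
theorem zagreb_le_of_odd_girth {h : ℕ} (hk : 3 ≤ k) (hh : 0 < h) (hm : h + (h + 1) + h < m)
    (hH : H.IsThetaBicyclic k n m) (hg : h = 1 ∨ H.HasGirth (2 * h + 1)) :
    H.zagreb ≤
        m * (k + 2) + 4 + 3 * (m - (h + (h + 1) + h)) + (m - (h + (h + 1) + h)) ^ 2 ∧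
      (H.zagreb =
        m * (k + 2) + 4 + 3 * (m - (h + (h + 1) + h)) + (m - (h + (h + 1) + h)) ^ 2 →
        (thetaTwoAttach k h (h + 1) h (m - (h + (h + 1) + h))).IsIso H) := by
  obtain ⟨p, q, l, hle, hgirth, hcases⟩ := hH.cases hk
  have hpq : h = 1 ∨ 2 * h + 1 ≤ p + q := hg.imp id (hgirth _)
  rcases hcases with ⟨hL, -, hz⟩ | ⟨hL, hc, hz⟩ | ⟨hL, hz⟩
  · unfold ThetaOneLengths at hL
    -- The first family needs at least `3 * h + 2` edges. With `s = m - (3 * h + 1)`, its bound `6 +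
    -- 3 * (s - 1) + (s - 1) ^ 2 = 4 + s + s ^ 2` is below `4 + 3 * s + s ^ 2` exactly because `0 <
    -- s`.
    have hs : m - (p + q + l) + 1 ≤ m - (h + (h + 1) + h) := by omega
    have h0 : 0 < m - (h + (h + 1) + h) := by omega
    have : H.zagreb <
        m * (k + 2) + 4 + 3 * (m - (h + (h + 1) + h)) + (m - (h + (h + 1) + h)) ^ 2 := by
      nlinarith
    exact ⟨this.le, fun heq => absurd heq this.ne⟩
  · unfold ThetaTwoLengths at hL
    -- For `h = 1` the length conditions alone give `4 ≤ p + q + l`. Otherwise, if `1 < q`, then `2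
    -- * h + 1 ≤ p + q` and `p ≤ q - 1 ≤ l` give `h + 1 ≤ q` and `h ≤ l`; if `q = 1`, the total is
    -- even larger.
    have hs : m - (p + q + l) ≤ m - (h + (h + 1) + h) := by omega
    refine ⟨by nlinarith, fun heq => ?_⟩
    have hs' : m - (h + (h + 1) + h) ≤ m - (p + q + l) := by
      by_contra! hlt
      nlinarith
    obtain ⟨rfl, rfl, rfl⟩ : p = h ∧ q = h + 1 ∧ l = h := by omega
    exact isIso_thetaTwoAttach hk hh (by omega) hh hH.1 hc heq
  · unfold ThetaThreeLengths at hL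
    have hs : m - (p + q + l) ≤ m - (h + (h + 1) + h) := by omega
    have : H.zagreb <
        m * (k + 2) + 4 + 3 * (m - (h + (h + 1) + h)) + (m - (h + (h + 1) + h)) ^ 2 := by
      nlinarith
    exact ⟨this.le, fun heq => absurd heq this.ne⟩

end Bounds

end Hypergraph

/-! ### The three extremal statements -/

theorem theorem3p4 (k m n : ℕ) (hk : 3 ≤ k) (hn : (n : ℤ) = m * ((k : ℤ) - 1) - 1) :
    -- even girth
    (∀ g : ℕ, 3 ≤ g → 3 * g ≤ 2 * m → Even g →
      (Hypergraph.thetaOneAttach k (g / 2) (g / 2) (g / 2) (m - 3 * g / 2)).IsThetaBicyclic k n m ∧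
      (Hypergraph.thetaOneAttach k (g / 2) (g / 2) (g / 2) (m - 3 * g / 2)).HasGirth g ∧
      ∀ (β : Type*) (H : Hypergraph β), H.IsThetaBicyclic k n m → H.HasGirth g →
        H.zagreb ≤
          (Hypergraph.thetaOneAttach k (g / 2) (g / 2) (g / 2) (m - 3 * g / 2)).zagreb ∧
        (H.zagreb =
            (Hypergraph.thetaOneAttach k (g / 2) (g / 2) (g / 2) (m - 3 * g / 2)).zagreb →
          (Hypergraph.thetaOneAttach k (g / 2) (g / 2) (g / 2) (m - 3 * g / 2)).IsIso H)) ∧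
    -- odd girth
    (∀ g : ℕ, 3 ≤ g → 3 * g ≤ 2 * m → Odd g →
      (Hypergraph.thetaTwoAttach k (g / 2) ((g + 1) / 2) (g / 2)
        (m - g - g / 2)).IsThetaBicyclic k n m ∧
      (Hypergraph.thetaTwoAttach k (g / 2) ((g + 1) / 2) (g / 2) (m - g - g / 2)).HasGirth g ∧
      ∀ (β : Type*) (H : Hypergraph β), H.IsThetaBicyclic k n m → H.HasGirth g →
        H.zagreb ≤
          (Hypergraph.thetaTwoAttach k (g / 2) ((g + 1) / 2) (g / 2) (m - g - g / 2)).zagreb ∧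
        (H.zagreb =
            (Hypergraph.thetaTwoAttach k (g / 2) ((g + 1) / 2) (g / 2) (m - g - g / 2)).zagreb →
          (Hypergraph.thetaTwoAttach k (g / 2) ((g + 1) / 2) (g / 2) (m - g - g / 2)).IsIso H)) ∧
    -- the whole class
    (6 ≤ m →
      (Hypergraph.thetaTwoAttach k 1 2 1 (m - 4)).IsThetaBicyclic k n m ∧
      ∀ (β : Type*) (H : Hypergraph β), H.IsThetaBicyclic k n m →
        H.zagreb ≤ (Hypergraph.thetaTwoAttach k 1 2 1 (m - 4)).zagreb ∧
        (H.zagreb = (Hypergraph.thetaTwoAttach k 1 2 1 (m - 4)).zagreb →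
          (Hypergraph.thetaTwoAttach k 1 2 1 (m - 4)).IsIso H)) := by
  refine ⟨fun g hg hgm heven => ?_, fun g hg hgm hodd => ?_, fun hm => ?_⟩
  · obtain ⟨h, rfl⟩ := even_iff_two_dvd.1 heven
    rw [show 2 * h / 2 = h by omega, show m - 3 * (2 * h) / 2 = m - (h + h + h) by omega]
    have hh : 0 < h := by omega
    have hm : h + h + h ≤ m := by omega
    refine ⟨Hypergraph.isThetaBicyclic_thetaOneAttach hk (Or.inr (by omega)) hm hn,
      Hypergraph.hasGirth_thetaOneAttach hk hh, fun β H hH hgirth => ?_⟩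
    rw [Hypergraph.zagreb_thetaOneAttach hk hh hh hh hm]
    exact Hypergraph.zagreb_le_of_even_girth hk hh hm hH hgirth
  · obtain ⟨h, rfl⟩ := hodd
    rw [show (2 * h + 1) / 2 = h by omega, show (2 * h + 1 + 1) / 2 = h + 1 by omega,
      show m - (2 * h + 1) - h = m - (h + (h + 1) + h) by omega]
    have hh : 0 < h := by omega
    -- `3 * (2 * h + 1) ≤ 2 * m` has an odd left side, so it gives `3 * h + 2 ≤ m`: at least one
    -- pendant edge is attached, which makes the comparison with the first family strict.
    have hm : h + (h + 1) + h < m := by omega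
    refine ⟨Hypergraph.isThetaBicyclic_thetaTwoAttach hk (Or.inr (by omega)) hm.le hn,
      Hypergraph.hasGirth_thetaTwoAttach hk hh, fun β H hH hgirth => ?_⟩
    rw [Hypergraph.zagreb_thetaTwoAttach hk hh (by omega) hh hm.le]
    exact Hypergraph.zagreb_le_of_odd_girth hk hh hm hH (Or.inr hgirth)
  · refine ⟨Hypergraph.isThetaBicyclic_thetaTwoAttach (p := 1) (q := 2) (l := 1) hk
      (Or.inr (by omega)) (by omega) hn, fun β H hH => ?_⟩
    have hz := Hypergraph.zagreb_thetaTwoAttach (p := 1) (q := 2) (l := 1) (m := m) hk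
      (by omega) (by omega) (by omega) (by omega)
    rw [show m - 4 = m - (1 + 2 + 1) by omega, hz]
    -- The overall maximum is the case `h = 1`, where the length conditions replace the girth
    -- assumption.
    exact Hypergraph.zagreb_le_of_odd_girth (h := 1) hk (by omega) (by omega) hH (Or.inl rfl)
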